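/- **Definitions.** An ordered group is a pair $(G,G^+)$ of a countable abelian group $G$ and a subset $G^+\subseteq G$ with $G^++G^+\subseteq G^+$, $G^+\cap(-G^+)=\{0\}$ and $G^+-G^+=G$. It is a *simple dimension group* if there are integers $d_i\ge 1$ and $d_{i+1}\times d_i$ matrices $A_i$ with strictly positive integer entries ($i\ge 0$) and a group isomorphism from $G$ onto the inductive limit $\varinjlim_i(\mathbb Z^{d_i},A_i)$ that carries $G^+$ onto the set of classes of vectors with nonnegative entries. An *order unit* is an element $u\in G^+$ such that for every $a\in G$ there is an integer $k\ge 0$ with $ku-a\in G^+$; then $(G,G^+,u)$ is a *simple dimension group with unit*. Two triples $(G,G^+,u)$ and $(H,H^+,v)$ are *isomorphic as ordered groups with unit* if some group isomorphism $\varphi:G\to H$ satisfies $\varphi(G^+)=H^+$ and $\varphi(u)=v$. For a finite alphabet $\mathcal A$, a subshift $(Y,S)$ is a closed shift-invariant set $Y\subseteq\mathcal A^{\mathbb Z}$ with the shift $S((x_i)_i)=(x_{i+1})_i$; it is *minimal* if $Y\neq\emptyset$ and its only closed $S$-invariant subsets are $\emptyset$ and $Y$. Its complexity $p_Y(n)$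 is the number of words of length $n$ that occur in elements of $Y$. It is a *Toeplitz subshift* if $Y$ is the closure of the shift orbit of a sequence $x\in\mathcal A^{\mathbb Z}$ such that for every $i\in\mathbb Z$ there is an integer $p\ge 1$ with $x_{i+kp}=x_i$ for all $k\in\mathbb Z$. Finally $K^0(Y,S)=(H,H^+,[1])$, where $H=C(Y,\mathbb Z)/\{f\circ S-f: f\in C(Y,\mathbb Z)\}$, $H^+$ is the set of classes of nonnegative functions, and $[1]$ is the class of the constant function $1$. **Theorem.** Let $(G,G^+,u)$ be a simple dimension group with unit such that $G$ is divisible (for all $g\in G$ and $k\ge 1$ there is $h\in G$ with $kh=g$), and let $(p_n)_{n\in\mathbb N}$ be a sequence of positive real numbers with $\lim_{n\to\infty} n/p_n=0$. Then there exists a minimal Toeplitz subshift $(Y,S)$ on a finite alphabet such that 1. $K^0(Y,S)$ and $(G,G^+,u)$ are isomorphic as ordered groups with unit; 2. $\lim_{n\to\infty} p_Y(n)/p_n=0$. -/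

import Mathlib

namespace DimToeplitz

/-! ### Ordered groups, order units, simple dimension groups -/

/-- `(G, P)` is an ordered group: `G` is a countable abelian group and
`P + P ⊆ P`, `P ∩ (-P) = {0}`, `P - P = G`. -/
structure IsOrderedGroup (G : Type*) [AddCommGroup G] (P : Set G) : Prop where
  countable : Countable G
  add_mem : ∀ a ∈ P, ∀ b ∈ P, a + b ∈ P
  inter_neg : {a : G | a ∈ P ∧ -a ∈ P} = {0}
  sub_eq : ∀ g : G, ∃ a ∈ P, ∃ b ∈ P, g = a - b

/-- `u` is an order unit for the positive cone `P`; here `a ≤ b` means `b - a ∈ P`. -/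
def IsOrderUnit {G : Type*} [AddCommGroup G] (P : Set G) (u : G) : Prop :=
  u ∈ P ∧ ∀ a : G, ∃ k : ℕ, k • u - a ∈ P

/-- The composition `A_{j-1} ⋯ A_i : ℤ^{d_i} → ℤ^{d_j}` for `i ≤ j`. -/
def transition {d : ℕ → ℕ} (A : ∀ i, Matrix (Fin (d (i + 1))) (Fin (d i)) ℤ)
    (i j : ℕ) (h : i ≤ j) : (Fin (d i) → ℤ) →+ (Fin (d j) → ℤ) :=
  Nat.leRec (motive := fun j _ => (Fin (d i) → ℤ) →+ (Fin (d j) → ℤ))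
    (AddMonoidHom.id _) (fun k _ g => (A k).mulVecLin.toAddMonoidHom.comp g) h

/-- The inductive limit of `ℤ^{d_0} → ℤ^{d_1} → ℤ^{d_2} → ⋯` along the matrices `A_i`. -/
abbrev IndLim {d : ℕ → ℕ} (A : ∀ i, Matrix (Fin (d (i + 1))) (Fin (d i)) ℤ) : Type :=
  AddCommGroup.DirectLimit (fun i => Fin (d i) → ℤ) (transition A)

/-- The positive cone of the induced order: classes `[x, i]` of vectors `x ∈ ℤ^{d_i}` with
nonnegative entries. -/
def indLimPos {d : ℕ → ℕ} (A : ∀ i, Matrix (Fin (d (i + 1))) (Fin (d i)) ℤ) : Set (IndLim A) :=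
  {z | ∃ (i : ℕ) (x : Fin (d i) → ℤ), 0 ≤ x ∧
    AddCommGroup.DirectLimit.of (fun i => Fin (d i) → ℤ) (transition A) i x = z}

/-- `(G, P)` is a simple dimension group: an ordered group isomorphic, as an ordered group, to an
inductive limit of groups `ℤ^{d_i}`, `d_i ≥ 1`, along matrices with strictly positive integer
entries. -/
structure IsSimpleDimensionGroup (G : Type*) [AddCommGroup G] (P : Set G) : Prop where
  ordered : IsOrderedGroup G P
  exists_limit : ∃ (d : ℕ → ℕ) (A : ∀ i, Matrix (Fin (d (i + 1))) (Fin (d i)) ℤ),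
    (∀ i, 1 ≤ d i) ∧ (∀ i k l, 0 < A i k l) ∧
      ∃ φ : G ≃+ IndLim A, φ '' P = indLimPos A

/-- `(G, P, u)` is a simple dimension group with unit. -/
structure IsSimpleDimensionGroupWithUnit (G : Type*) [AddCommGroup G] (P : Set G) (u : G) :
    Prop where
  simple : IsSimpleDimensionGroup G P
  unit : IsOrderUnit P u

/-- `(G, P, u)` and `(H, Q, v)` are isomorphic as ordered groups with unit. -/
def OrderedGroupIso {G H : Type*} [AddCommGroup G] [AddCommGroup H]
    (P : Set G) (u : G) (Q : Set H) (v : H) : Prop :=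
  ∃ φ : G ≃+ H, φ '' P = Q ∧ φ u = v

/-! ### Dynamical systems and the dynamical dimension group `K⁰(X, T)` -/

section Dynamics

variable {X : Type*} [TopologicalSpace X]

/-- `(X, T)` is minimal: `X` is nonempty and has no closed `T`-invariant subsets other than `∅`
and `X`. -/
def IsMinimalSystem (T : X ≃ₜ X) : Prop :=
  Nonempty X ∧ ∀ C : Set X, IsClosed C → T '' C = C → C = ∅ ∨ C = Set.univ

/-- The coboundary map `f ↦ f ∘ T - f` on `C(X, ℤ)`. -/
def coboundary (T : X ≃ₜ X) : C(X, ℤ) →+ C(X, ℤ) where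
  toFun f := f.comp (T : C(X, X)) - f
  map_zero' := by ext; simp
  map_add' f g := by ext; simp; ring

/-- `H(X, T) = C(X, ℤ) / β C(X, ℤ)`. -/
abbrev DynH (T : X ≃ₜ X) : Type _ := C(X, ℤ) ⧸ (coboundary T).range

/-- `H⁺(X, T)`: the classes of nonnegative functions. -/
def dynHPos (T : X ≃ₜ X) : Set (DynH T) :=
  {z | ∃ f : C(X, ℤ), (∀ x, 0 ≤ f x) ∧ (QuotientAddGroup.mk f : DynH T) = z}

/-- The class of the constant function `1`. -/
def dynHUnit (T : X ≃ₜ X) : DynH T :=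
  QuotientAddGroup.mk (ContinuousMap.const X (1 : ℤ))

end Dynamics

/-! ### Subshifts, complexity, Toeplitz subshifts -/

open SymbolicDynamics.FullShift

section Subshifts

variable {α : Type*} [TopologicalSpace α]

/-- The shift `(x_i) ↦ (x_{i+1})` restricted to a subshift `Y ⊆ α^ℤ`. -/
def shiftHomeo (Y : Subshift α ℤ) : Y.carrier ≃ₜ Y.carrier where
  toFun x := ⟨shift 1 x.1, Y.mapsTo 1 x.2⟩
  invFun x := ⟨shift (-1) x.1, Y.mapsTo (-1) x.2⟩
  left_inv x := by ext i; simp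
  right_inv x := by ext i; simp
  continuous_toFun := by fun_prop
  continuous_invFun := by fun_prop

/-- The words of length `n` in the language of `Y`. -/
def languageOfLength (Y : Subshift α ℤ) (n : ℕ) : Set (Fin n → α) :=
  {w | ∃ x ∈ Y.carrier, ∃ i : ℤ, ∀ j : Fin n, w j = x (i + (j : ℕ))}

/-- The factor complexity `p_Y(n)`. -/
noncomputable def complexity (Y : Subshift α ℤ) (n : ℕ) : ℕ :=
  (languageOfLength Y n).ncard

/-- A Toeplitz sequence: every position belongs to an arithmetic progression, of period `p ≥ 1`,
along which the sequence is constant. -/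
def IsToeplitzSeq {β : Type*} (x : ℤ → β) : Prop :=
  ∀ i : ℤ, ∃ p : ℕ, 1 ≤ p ∧ ∀ k : ℤ, x i = x (i + k * p)

/-- A Toeplitz subshift is the orbit closure of a Toeplitz sequence. -/
def IsToeplitzSubshift (Y : Subshift α ℤ) : Prop :=
  ∃ x : ℤ → α, IsToeplitzSeq x ∧ Y.carrier = closure (Set.range fun k : ℤ => shift k x)

end Subshifts

end DimToeplitz

/-!
Divisibility allows the connecting matrices of a dimension group to be changed within wide
limits: rescaling the coordinates at each stage, one presents `(G, G⁺, u)` by matrices `B i` with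
entries at least `t i` and all row sums equal to `m i = K i * t i`, with `u` the class of
`(1, …, 1)` at level `0`. The sizes `d i` and the factors `K i` do not depend on the `t i`, which
are arbitrary. Rows of equal sum `m i` are the letter counts of a substitution of constant length
`m i`. If its words share their first and their last letters and their seams can be recognized,
then iterating the substitutions gives a Toeplitz sequence, and sending a function on its orbit
closure to the class of the vector of its sums along the words of level `i` identifies `K⁰` with
`(G, G⁺, u)`.

For low complexity the words list their letters in long runs in increasing order, apart from a
short tag which distinguishes them: between the heights `h i` and `h (i + 1)` of two consecutive
levels, `h i` being `m 0 ⋯ m (i - 1)`, the complexity is at most `C i * n` with `C i` depending on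
`d i`, `d (i + 1)` and `K i` but not on `t i`. As `n / p n → 0`, taking `t i` large makes level
`i + 1` start only beyond the point where `C (i + 1) * n` is negligible compared with `p n`.
-/

namespace DimToeplitz

open SymbolicDynamics.FullShift
open scoped Matrix

/-! ### Presentations of ordered groups by nonnegative integer matrices -/

section Transition

variable {d : ℕ → ℕ} (A : ∀ i, Matrix (Fin (d (i + 1))) (Fin (d i)) ℤ) {i j k : ℕ}

lemma transition_self (i : ℕ) (v : Fin (d i) → ℤ) : transition A i i le_rfl v = v := by
  simp [transition]

lemma transition_succ (h : i ≤ j) (v : Fin (d i) → ℤ) :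
    transition A i (j + 1) (Nat.le_succ_of_le h) v = A j *ᵥ transition A i j h v := by
  rw [transition, Nat.leRec_succ _ _ h]
  rfl

lemma transition_trans (hij : i ≤ j) (hjk : j ≤ k) (v : Fin (d i) → ℤ) :
    transition A j k hjk (transition A i j hij v) = transition A i k (hij.trans hjk) v := by
  induction k, hjk using Nat.le_induction with
  | base => exact transition_self A j _
  | succ k hjk ih => rw [transition_succ A hjk, ih, transition_succ A (hij.trans hjk)]

lemma directedSystem_transition :
    DirectedSystem (fun i => Fin (d i) → ℤ) fun i j h => transition A i j h where
  map_self _ v := transition_self A _ v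
  map_map _ _ _ hij hjk v := transition_trans A hij hjk v

lemma transition_shift (n : ℕ) (h : i ≤ j) (v : Fin (d (n + i)) → ℤ) :
    transition (d := fun i => d (n + i)) (fun i => A (n + i)) i j h v =
      transition A (n + i) (n + j) (Nat.add_le_add_left h n) v := by
  induction j, h using Nat.le_induction with
  | base => rw [transition_self, transition_self]
  | succ j h ih =>
    rw [transition_succ _ h, ih]
    exact (transition_succ A (Nat.add_le_add_left h n) v).symm

variable {A}

lemma mulVec_nonneg {m n : Type*} [Fintype n] {M : Matrix m n ℤ} (hM : ∀ k l, 0 ≤ M k l)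
    {v : n → ℤ} (hv : 0 ≤ v) : 0 ≤ M *ᵥ v :=
  fun k => dotProduct_nonneg_of_nonneg (hM k) hv

lemma mulVec_pos {m n : Type*} [Fintype n] {M : Matrix m n ℤ} (hM : ∀ k l, 0 < M k l)
    {v : n → ℤ} (hv : 0 < v) (k : m) : 0 < (M *ᵥ v) k := by
  obtain ⟨hv₀, l, hl⟩ := Pi.lt_def.1 hv
  exact Finset.sum_pos' (fun l _ => mul_nonneg (hM k l).le (hv₀ l))
    ⟨l, Finset.mem_univ l, mul_pos (hM k l) hl⟩

lemma transition_nonneg (hA : ∀ i k l, 0 ≤ A i k l) (h : i ≤ j) {v : Fin (d i) → ℤ}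
    (hv : 0 ≤ v) : 0 ≤ transition A i j h v := by
  induction j, h using Nat.le_induction with
  | base => rwa [transition_self]
  | succ j h ih => rw [transition_succ A h]; exact mulVec_nonneg (hA j) ih

lemma lt_of_forall_pos {n : ℕ} (hn : 1 ≤ n) {v : Fin n → ℤ} (hv : ∀ k, 0 < v k) : 0 < v :=
  Pi.lt_def.2 ⟨fun k => (hv k).le, ⟨0, hn⟩, hv _⟩

lemma transition_pos (hd : ∀ i, 1 ≤ d i) (hA : ∀ i k l, 0 < A i k l) (h : i ≤ j)
    {v : Fin (d i) → ℤ} (hv : ∀ k, 0 < v k) (k : Fin (d j)) : 0 < transition A i j h v k := by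
  induction j, h using Nat.le_induction with
  | base => rw [transition_self]; exact hv k
  | succ j h ih =>
    rw [transition_succ A h]
    exact mulVec_pos (hA j) (lt_of_forall_pos (hd j) ih) k

end Transition

/-- The homomorphisms `γ i : ℤ^{d i} → G` exhibit `(G, P)` as the ordered inductive limit of
the system given by the matrices `A i`. -/
structure IsPresentation {G : Type*} [AddCommGroup G] (P : Set G) {d : ℕ → ℕ}
    (A : ∀ i, Matrix (Fin (d (i + 1))) (Fin (d i)) ℤ) (γ : ∀ i, (Fin (d i) → ℤ) →+ G) :
    Prop where
  compat : ∀ i v, γ (i + 1) (A i *ᵥ v) = γ i v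
  surj : ∀ g, ∃ i v, γ i v = g
  vanishes : ∀ i v, γ i v = 0 → ∃ (j : ℕ) (h : i ≤ j), transition A i j h v = 0
  mem_iff : ∀ g, g ∈ P ↔ ∃ i v, 0 ≤ v ∧ γ i v = g

section Presentation

variable {G : Type*} [AddCommGroup G] {P : Set G} {u : G} {d : ℕ → ℕ}
  {A : ∀ i, Matrix (Fin (d (i + 1))) (Fin (d i)) ℤ} {γ : ∀ i, (Fin (d i) → ℤ) →+ G}

lemma IsPresentation.map_transition (h : IsPresentation P A γ) {i j : ℕ} (hij : i ≤ j)
    (v : Fin (d i) → ℤ) : γ j (transition A i j hij v) = γ i v := by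
  induction j, hij using Nat.le_induction with
  | base => rw [transition_self]
  | succ j hij ih => rw [transition_succ A hij, h.compat, ih]

lemma IsPresentation.nsmul_injective (h : IsPresentation P A γ) {n : ℕ} (hn : n ≠ 0) :
    Function.Injective fun g : G => n • g := by
  refine (injective_iff_map_eq_zero (nsmulAddMonoidHom (α := G) n)).2 fun g hg => ?_
  obtain ⟨i, v, rfl⟩ := h.surj g
  obtain ⟨j, hij, hj⟩ := h.vanishes i (n • v) ((map_nsmul (γ i) n v).trans hg)
  rw [map_nsmul, smul_eq_zero] at hj
  rw [← h.map_transition hij, hj.resolve_left hn, map_zero]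

lemma IsPresentation.mem_of_nsmul_mem (h : IsPresentation P A γ) (hA : ∀ i k l, 0 ≤ A i k l)
    {n : ℕ} (hn : n ≠ 0) {g : G} (hg : n • g ∈ P) : g ∈ P := by
  obtain ⟨i, v, rfl⟩ := h.surj g
  obtain ⟨i', w, hw, hwg⟩ := (h.mem_iff _).1 hg
  obtain ⟨j, hij, hi'j⟩ : ∃ j, i ≤ j ∧ i' ≤ j := ⟨_, le_max_left i i', le_max_right i i'⟩
  obtain ⟨k, hjk, hk⟩ := h.vanishes j (n • transition A i j hij v - transition A i' j hi'j w)
    (by rw [map_sub, map_nsmul, h.map_transition, h.map_transition, hwg, sub_self])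
  rw [map_sub, map_nsmul, transition_trans, transition_trans, sub_eq_zero] at hk
  refine (h.mem_iff _).2 ⟨k, transition A i k (hij.trans hjk) v, fun l => ?_,
    h.map_transition _ v⟩
  have hl : 0 ≤ (n • transition A i k (hij.trans hjk) v) l :=
    hk ▸ transition_nonneg hA (hi'j.trans hjk) hw l
  exact (nsmul_nonneg_iff hn).1 hl

lemma IsPresentation.shift_levels (h : IsPresentation P A γ) (hA : ∀ i k l, 0 ≤ A i k l)
    (n : ℕ) :
    IsPresentation P (d := fun i => d (n + i)) (fun i => A (n + i)) (fun i => γ (n + i)) where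
  compat i v := h.compat (n + i) v
  surj g := by
    obtain ⟨i, v, rfl⟩ := h.surj g
    exact ⟨i, _, h.map_transition (Nat.le_add_left i n) v⟩
  vanishes i v hv := by
    obtain ⟨j, hij, hj⟩ := h.vanishes _ v hv
    obtain ⟨j, rfl⟩ := Nat.exists_eq_add_of_le (Nat.le_of_add_right_le hij)
    have hij' : i ≤ j := Nat.le_of_add_le_add_left hij
    exact ⟨j, hij', (transition_shift A n hij' v).trans hj⟩
  mem_iff g := by
    rw [h.mem_iff]
    constructor
    · rintro ⟨i, v, hv, rfl⟩
      exact ⟨i, _, transition_nonneg hA (Nat.le_add_left i n) hv, h.map_transition _ v⟩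
    · rintro ⟨i, v, hv, rfl⟩
      exact ⟨n + i, v, hv, rfl⟩

lemma exists_presentation (hG : IsSimpleDimensionGroup G P) :
    ∃ (d : ℕ → ℕ) (A : ∀ i, Matrix (Fin (d (i + 1))) (Fin (d i)) ℤ)
      (γ : ∀ i, (Fin (d i) → ℤ) →+ G),
      (∀ i, 1 ≤ d i) ∧ (∀ i k l, 0 < A i k l) ∧ IsPresentation P A γ := by
  obtain ⟨d, A, hd, hA, φ, hφ⟩ := hG.exists_limit
  have := directedSystem_transition A
  let ι := fun i => AddCommGroup.DirectLimit.of (fun i => Fin (d i) → ℤ) (transition A) i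
  refine ⟨d, A, fun i => φ.symm.toAddMonoidHom.comp (ι i), hd, hA, fun i v => ?_, fun g => ?_,
    fun i v hv => ?_, fun g => ?_⟩
  · have hv : transition A i (i + 1) (Nat.le_succ i) v = A i *ᵥ v := by
      rw [transition_succ A le_rfl, transition_self]
    rw [← hv]
    exact congrArg φ.symm (AddCommGroup.DirectLimit.of_f (f := transition A) (Nat.le_succ i) v)
  · obtain ⟨z, rfl⟩ := φ.symm.surjective g
    induction z using AddCommGroup.DirectLimit.induction_on with
    | ih i v => exact ⟨i, v, rfl⟩
  · exact AddCommGroup.DirectLimit.of.zero_exact (G := fun i => Fin (d i) → ℤ)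
      (f := transition A) i v (φ.symm.injective (hv.trans (map_zero φ.symm).symm))
  · rw [← φ.injective.mem_set_image, hφ]
    exact exists₂_congr fun i v => and_congr_right fun _ => (φ.symm_apply_eq).symm

lemma IsOrderUnit.ne_zero (hP : IsOrderedGroup G P) (hu : IsOrderUnit P u) {g : G}
    (hg : g ≠ 0) : u ≠ 0 := by
  rintro rfl
  have hmem : ∀ a : G, -a ∈ P := fun a => by
    obtain ⟨k, hk⟩ := hu.2 a
    rwa [smul_zero, zero_sub] at hk
  have : g ∈ {a : G | a ∈ P ∧ -a ∈ P} := ⟨neg_neg g ▸ hmem (-g), hmem g⟩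
  rw [hP.inter_neg] at this
  exact hg this

lemma exists_presentation_unit (hG : IsSimpleDimensionGroupWithUnit G P u) :
    ∃ (d : ℕ → ℕ) (A : ∀ i, Matrix (Fin (d (i + 1))) (Fin (d i)) ℤ)
      (γ : ∀ i, (Fin (d i) → ℤ) →+ G) (x : Fin (d 0) → ℤ),
      (∀ i, 1 ≤ d i) ∧ (∀ i k l, 0 < A i k l) ∧ IsPresentation P A γ ∧
      (∀ k, 0 < x k) ∧ γ 0 x = u := by
  obtain ⟨d, A, γ, hd, hA, h⟩ := exists_presentation hG.simple
  have hone : γ 0 1 ≠ 0 := fun h0 => by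
    obtain ⟨j, hj, hj0⟩ := h.vanishes 0 1 h0
    have := transition_pos hd hA hj (v := 1) (fun _ => one_pos) ⟨0, hd j⟩
    exact this.ne' (congrFun hj0 _)
  obtain ⟨i, v, hv, hu⟩ := (h.mem_iff u).1 hG.unit.1
  have hv0 : v ≠ 0 := by
    rintro rfl
    exact hG.unit.ne_zero hG.simple.ordered hone (hu.symm.trans (map_zero _))
  exact ⟨fun j => d (i + 1 + j), fun j => A (i + 1 + j), fun j => γ (i + 1 + j), A i *ᵥ v,
    fun j => hd _, fun j => hA _, h.shift_levels (fun i k l => (hA i k l).le) (i + 1),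
    mulVec_pos (hA i) (hv.lt_of_ne' hv0), (h.compat i v).trans hu⟩

lemma exists_nsmul_eq_of_divisible {F : Type*} [AddCommGroup F] [Module.Free ℤ F] {n : ℕ}
    (hn : ∀ g : G, ∃ h : G, n • h = g) (f : F →+ G) : ∃ f' : F →+ G, ∀ v, n • f' v = f v := by
  obtain ⟨f', hf'⟩ := Module.projective_lifting_property
    (nsmulAddMonoidHom (α := G) n).toIntLinearMap f.toIntLinearMap hn
  exact ⟨f'.toAddMonoidHom, DFunLike.congr_fun hf'⟩

/-- `B i` is `A i` in the rational coordinates `(N i)⁻¹ • C i`; the one-sided inverses `S i`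
show that no element of the cone is lost. -/
lemma IsPresentation.rescale (h : IsPresentation P A γ) (hA : ∀ i k l, 0 ≤ A i k l)
    {e : ℕ → ℕ} {B : ∀ i, Matrix (Fin (e (i + 1))) (Fin (e i)) ℤ}
    {C : ∀ i, Matrix (Fin (d i)) (Fin (e i)) ℤ}
    {S : ∀ i, Matrix (Fin (e (i + 1))) (Fin (d (i + 1))) ℤ} {N m : ℕ → ℕ}
    (hN : ∀ i, N i ≠ 0) (hNm : ∀ i, N (i + 1) = N i * m i)
    (hC : ∀ i k l, 0 ≤ C i k l) (hS : ∀ i k l, 0 ≤ S i k l)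
    (hCB : ∀ i, C (i + 1) * B i = m i • (A i * C i))
    (hker : ∀ i v, C i *ᵥ v = 0 → B i *ᵥ v = 0)
    (hCS : ∀ i, C (i + 1) * S i = N (i + 1) • 1)
    {γ' : ∀ i, (Fin (e i) → ℤ) →+ G} (hγ' : ∀ i v, N i • γ' i v = γ i (C i *ᵥ v)) :
    IsPresentation P B γ' := by
  have mulVec_B : ∀ i v, C (i + 1) *ᵥ (B i *ᵥ v) = m i • (A i *ᵥ (C i *ᵥ v)) := fun i v => by
    rw [Matrix.mulVec_mulVec, hCB, Matrix.smul_mulVec, Matrix.mulVec_mulVec]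
  have lift : ∀ i v, γ' (i + 1) (S i *ᵥ (A i *ᵥ v)) = γ i v := fun i v => by
    refine h.nsmul_injective (hN (i + 1)) ?_
    simp only
    rw [hγ', Matrix.mulVec_mulVec, hCS, Matrix.smul_mulVec, Matrix.one_mulVec, map_nsmul,
      h.compat]
  refine ⟨fun i v => h.nsmul_injective (hN (i + 1)) ?_, fun g => ?_, fun i v hv => ?_,
    fun g => ⟨?_, ?_⟩⟩
  · simp only
    rw [hγ', mulVec_B, map_nsmul, h.compat, ← hγ', ← mul_smul, hNm, mul_comm]
  · obtain ⟨i, v, rfl⟩ := h.surj g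
    exact ⟨i + 1, _, lift i v⟩
  · obtain ⟨j, hij, hj⟩ := h.vanishes i (C i *ᵥ v) (by rw [← hγ', hv, smul_zero])
    have multiple : ∃ c : ℕ,
        C j *ᵥ transition B i j hij v = c • transition A i j hij (C i *ᵥ v) := by
      clear hj
      induction j, hij using Nat.le_induction with
      | base => exact ⟨1, by rw [transition_self, transition_self, one_smul]⟩
      | succ j hij ih =>
        obtain ⟨c, hc⟩ := ih
        refine ⟨m j * c, ?_⟩
        rw [transition_succ B hij, mulVec_B, hc, transition_succ A hij, Matrix.mulVec_smul,
          mul_smul]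
    obtain ⟨c, hc⟩ := multiple
    refine ⟨j + 1, Nat.le_succ_of_le hij, ?_⟩
    rw [transition_succ B hij]
    exact hker j _ (by rw [hc, hj, smul_zero])
  · intro hg
    obtain ⟨i, v, hv, rfl⟩ := (h.mem_iff g).1 hg
    exact ⟨i + 1, _, mulVec_nonneg (hS i) (mulVec_nonneg (hA i) hv), lift i v⟩
  · rintro ⟨i, v, hv, rfl⟩
    refine h.mem_of_nsmul_mem hA (hN i) ((h.mem_iff _).2 ⟨i, _, mulVec_nonneg (hC i) hv, ?_⟩)
    exact (hγ' i v).symm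

/-- The matrix adding up the two copies of each coordinate of `ℤ^d` in `ℤ^(d * 2)`; the copies of
`k` are the `K` with `K.divNat = k`. -/
def foldMatrix (d : ℕ) : Matrix (Fin d) (Fin (d * 2)) ℤ :=
  (1 : Matrix (Fin d) (Fin d) ℤ).submatrix id Fin.divNat

lemma sum_comp_divNat {β : Type*} [AddCommMonoid β] {d : ℕ} (f : Fin d → β) :
    ∑ K : Fin (d * 2), f K.divNat = 2 • ∑ k, f k := by
  rw [← finProdFinEquiv.sum_comp, Fintype.sum_prod_type, Finset.smul_sum]
  refine Finset.sum_congr rfl fun k _ => ?_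
  have hk : ∀ s : Fin 2, (finProdFinEquiv (k, s)).divNat = k := fun s =>
    congrArg Prod.fst (finProdFinEquiv.symm_apply_apply (k, s))
  simp [hk]

lemma foldMatrix_mul_transpose (d : ℕ) : foldMatrix d * (foldMatrix d)ᵀ = 2 • 1 := by
  ext k l
  exact (sum_comp_divNat fun j =>
    (1 : Matrix (Fin d) (Fin d) ℤ) k j * (1 : Matrix (Fin d) (Fin d) ℤ) l j).trans (by
      simp [Matrix.one_apply])

lemma foldMatrix_mulVec_comp_divNat {d : ℕ} (x : Fin d → ℤ) :
    foldMatrix d *ᵥ (x ∘ Fin.divNat) = 2 • x := by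
  ext k
  exact (sum_comp_divNat fun j => (1 : Matrix (Fin d) (Fin d) ℤ) k j * x j).trans (by
    simp [Matrix.one_apply])

lemma submatrix_divNat_eq_mul {a b : ℕ} (M : Matrix (Fin a) (Fin b) ℤ) :
    M.submatrix Fin.divNat Fin.divNat = (foldMatrix a)ᵀ * M * foldMatrix b := by
  rw [foldMatrix, foldMatrix, Matrix.transpose_submatrix, Matrix.transpose_one]
  exact ((congrArg (· * _) (Matrix.one_submatrix_mul Fin.divNat (.refl (Fin a)) M)).trans
    (Matrix.mul_submatrix_one (.refl (Fin b)) Fin.divNat _)).symm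

lemma exists_presentation_two_le (hG : IsSimpleDimensionGroupWithUnit G P u)
    (hdiv : ∀ (g : G) (k : ℕ), 1 ≤ k → ∃ h : G, k • h = g) :
    ∃ (d : ℕ → ℕ) (A : ∀ i, Matrix (Fin (d (i + 1))) (Fin (d i)) ℤ)
      (γ : ∀ i, (Fin (d i) → ℤ) →+ G) (x : Fin (d 0) → ℤ),
      (∀ i, 2 ≤ d i) ∧ (∀ i k l, 0 < A i k l) ∧ IsPresentation P A γ ∧
      (∀ k, 0 < x k) ∧ γ 0 x = u := by
  obtain ⟨d, A, γ, x, hd, hA, h, hx, rfl⟩ := exists_presentation_unit hG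
  choose γ' hγ' using fun i => exists_nsmul_eq_of_divisible (n := 2 ^ (i + 1))
    (fun g => hdiv g _ Nat.one_le_two_pow) ((γ i).comp (foldMatrix (d i)).mulVecLin.toAddMonoidHom)
  have hA' : ∀ i k l, 0 ≤ A i k l := fun i k l => (hA i k l).le
  have fold_nonneg : ∀ i k l, 0 ≤ foldMatrix (d i) k l := fun i k l => by
    simp only [foldMatrix, Matrix.submatrix_apply, Matrix.one_apply]
    split_ifs <;> simp
  refine ⟨fun i => d i * 2, fun i => (A i).submatrix Fin.divNat Fin.divNat, γ', x ∘ Fin.divNat,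
    fun i => Nat.mul_le_mul_right 2 (hd i), fun i k l => hA i _ _, ?_, fun k => hx _, ?_⟩
  · refine h.rescale hA' (C := fun i => foldMatrix (d i))
      (S := fun i => 2 ^ (i + 1) • (foldMatrix (d (i + 1)))ᵀ) (m := fun _ => 2)
      (fun i => pow_ne_zero (i + 1) two_ne_zero) (fun i => pow_succ 2 (i + 1)) fold_nonneg
      (fun i k l => nsmul_nonneg (fold_nonneg _ _ _) _) (fun i => ?_) (fun i v hv => ?_)
      (fun i => ?_) hγ'
    · rw [submatrix_divNat_eq_mul, ← Matrix.mul_assoc, ← Matrix.mul_assoc,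
        foldMatrix_mul_transpose, Matrix.smul_mul, Matrix.one_mul, Matrix.smul_mul]
    · rw [submatrix_divNat_eq_mul, ← Matrix.mulVec_mulVec, hv, Matrix.mulVec_zero]
    · rw [Matrix.mul_smul, foldMatrix_mul_transpose, ← mul_smul, ← pow_succ]
  · refine h.nsmul_injective two_ne_zero ((hγ' 0 _).trans ?_)
    exact (congrArg (γ 0) (foldMatrix_mulVec_comp_divNat x)).trans (map_nsmul _ _ _)

section BalancedMatrix

variable {m n : Type*} [Fintype m] [DecidableEq m] [Fintype n] [DecidableEq n]

/-- The products of all coordinates of `x` but one: `x⁻¹` up to the factor `∏ k, x k`. -/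
def coordCofactor (x : m → ℤ) (k : m) : ℤ := ∏ l ∈ Finset.univ.erase k, x l

/-- The matrix `t * diag(M x)⁻¹ * M * diag(x)`, whose rows all have sum `t`, with denominators
cleared. -/
def balancedMatrix (M : Matrix m n ℤ) (x : n → ℤ) (t : ℕ) : Matrix m n ℤ :=
  t • (Matrix.diagonal (coordCofactor (M *ᵥ x)) * (M * Matrix.diagonal x))

lemma diagonal_mul_coordCofactor (x : m → ℤ) :
    Matrix.diagonal x * Matrix.diagonal (coordCofactor x) = (∏ k, x k) • 1 := by
  have h : (fun k => x k * coordCofactor x k) = fun _ => ∏ k, x k :=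
    funext fun k => Finset.mul_prod_erase _ x (Finset.mem_univ k)
  rw [Matrix.diagonal_mul_diagonal, h, Matrix.smul_one_eq_diagonal]

lemma coordCofactor_pos {x : m → ℤ} (hx : ∀ k, 0 < x k) (k : m) : 0 < coordCofactor x k :=
  Finset.prod_pos fun l _ => hx l

lemma diagonal_nonneg {m : Type*} [DecidableEq m] {x : m → ℤ} (hx : ∀ k, 0 < x k) (k l : m) :
    0 ≤ Matrix.diagonal x k l := by
  rw [Matrix.diagonal_apply]
  split_ifs
  exacts [(hx k).le, le_rfl]

variable {M : Matrix m n ℤ} {x : n → ℤ} {t : ℕ}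

lemma balancedMatrix_apply (k : m) (l : n) :
    balancedMatrix M x t k l = t * (coordCofactor (M *ᵥ x) k * (M k l * x l)) := by
  simp [balancedMatrix]

lemma le_balancedMatrix (hM : ∀ k l, 0 < M k l) (hx : ∀ l, 0 < x l)
    (hMx : ∀ k, 0 < (M *ᵥ x) k) (k : m) (l : n) : (t : ℤ) ≤ balancedMatrix M x t k l := by
  rw [balancedMatrix_apply]
  exact le_mul_of_one_le_right (Int.natCast_nonneg _) (Int.add_one_le_of_lt
    (mul_pos (coordCofactor_pos hMx k) (mul_pos (hM k l) (hx l))))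

lemma sum_balancedMatrix (k : m) :
    ∑ l, balancedMatrix M x t k l = (∏ k, (M *ᵥ x) k) * t := by
  simp only [balancedMatrix_apply, ← Finset.mul_sum]
  rw [mul_comm, mul_comm (coordCofactor _ k)]
  exact congrArg (· * (t : ℤ)) (Finset.mul_prod_erase _ (M *ᵥ x) (Finset.mem_univ k))

lemma diagonal_mul_balancedMatrix :
    Matrix.diagonal (M *ᵥ x) * balancedMatrix M x t =
      ((∏ k, (M *ᵥ x) k) * t) • (M * Matrix.diagonal x) := by
  rw [balancedMatrix, Matrix.mul_smul, ← Matrix.mul_assoc, diagonal_mul_coordCofactor,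
    Matrix.smul_mul, Matrix.one_mul, mul_comm, mul_smul, natCast_zsmul]

lemma balancedMatrix_mulVec_eq_zero {v : n → ℤ} (hv : Matrix.diagonal x *ᵥ v = 0) :
    balancedMatrix M x t *ᵥ v = 0 := by
  rw [balancedMatrix, Matrix.smul_mulVec, ← Matrix.mulVec_mulVec, ← Matrix.mulVec_mulVec, hv,
    Matrix.mulVec_zero, Matrix.mulVec_zero, smul_zero]

end BalancedMatrix

theorem exists_balanced_presentation (hG : IsSimpleDimensionGroupWithUnit G P u)
    (hdiv : ∀ (g : G) (k : ℕ), 1 ≤ k → ∃ h : G, k • h = g) :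
    ∃ d K : ℕ → ℕ, (∀ i, 2 ≤ d i) ∧ (∀ i, 1 ≤ K i) ∧ ∀ t : ℕ → ℕ, (∀ i, 1 ≤ t i) →
      ∃ (B : ∀ i, Matrix (Fin (d (i + 1))) (Fin (d i)) ℤ) (γ : ∀ i, (Fin (d i) → ℤ) →+ G),
        (∀ i k l, (t i : ℤ) ≤ B i k l) ∧ (∀ i k, ∑ l, B i k l = (K i * t i : ℕ)) ∧
        IsPresentation P B γ ∧ γ 0 1 = u := by
  obtain ⟨d, A, γ, x₀, hd, hA, h, hx₀, rfl⟩ := exists_presentation_two_le hG hdiv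
  set x : ∀ i, Fin (d i) → ℤ := fun i => transition A 0 i i.zero_le x₀
  have hx : ∀ i k, 0 < x i k := fun i =>
    transition_pos (fun i => one_le_two.trans (hd i)) hA i.zero_le hx₀
  have hx_succ : ∀ i, x (i + 1) = A i *ᵥ x i := fun i => transition_succ A i.zero_le x₀
  have hAx : ∀ i k, 0 < (A i *ᵥ x i) k := fun i => hx_succ i ▸ hx (i + 1)
  set K : ℕ → ℕ := fun i => (∏ k, (A i *ᵥ x i) k).toNat
  have hK : ∀ i, ∏ k, (A i *ᵥ x i) k = K i := fun i =>
    (Int.toNat_of_nonneg (Finset.prod_nonneg fun k _ => (hAx i k).le)).symm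
  have hKpos : ∀ i, 0 < K i := fun i => Int.lt_toNat.2 (Finset.prod_pos fun k _ => hAx i k)
  refine ⟨d, K, hd, hKpos, fun t ht => ?_⟩
  set N : ℕ → ℕ := fun i => ∏ j ∈ Finset.range i, K j * t j
  have hN : ∀ i, 0 < N i := fun i => Finset.prod_pos fun j _ => Nat.mul_pos (hKpos j) (ht j)
  have hN_succ : ∀ i, N (i + 1) = N i * (K i * t i) := fun i => Finset.prod_range_succ _ i
  choose γ' hγ' using fun i => exists_nsmul_eq_of_divisible (n := N i)
    (fun g => hdiv g _ (hN i)) ((γ i).comp (Matrix.diagonal (x i)).mulVecLin.toAddMonoidHom)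
  refine ⟨fun i => balancedMatrix (A i) (x i) (t i), γ',
    fun i => le_balancedMatrix (hA i) (hx i) (hAx i),
    fun i k => by rw [sum_balancedMatrix, hK, Nat.cast_mul], ?_, ?_⟩
  · refine h.rescale (fun i k l => (hA i k l).le) (C := fun i => Matrix.diagonal (x i))
      (S := fun i => (N i * t i) • Matrix.diagonal (coordCofactor (A i *ᵥ x i)))
      (fun i => (hN i).ne') hN_succ (fun i => diagonal_nonneg (hx i))
      (fun i k l => nsmul_nonneg (diagonal_nonneg (coordCofactor_pos (hAx i)) k l) _)
      (fun i => ?_) (fun i v => balancedMatrix_mulVec_eq_zero) (fun i => ?_) hγ'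
    · rw [hx_succ, diagonal_mul_balancedMatrix, hK, ← Nat.cast_mul, natCast_zsmul]
    · rw [hx_succ, Matrix.mul_smul, diagonal_mul_coordCofactor, hK, natCast_zsmul, ← mul_smul,
        hN_succ]
      congr 1
      ring
  · have hu : γ' 0 1 = γ 0 (Matrix.diagonal (x 0) *ᵥ 1) := by simpa [N] using hγ' 0 1
    rw [hu]
    congr 1
    ext k
    rw [Matrix.mulVec_diagonal, Pi.one_apply, mul_one]
    exact congrFun (transition_self A 0 x₀) k

end Presentation

/-! ### Words made of runs -/

section Runs

variable {d : ℕ} {r : ℕ → ℕ} {k b s : ℕ}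

/-- The letters of the word `0^{r 0} 1^{r 1} ⋯ (d-1)^{r (d-1)}`, where the letter at position `s`
is the last `l` such that the runs of smaller letters end at or before `s`. -/
def runLetter (d : ℕ) (r : ℕ → ℕ) (s : ℕ) : ℕ :=
  Nat.findGreatest (fun l => ∑ j ∈ Finset.range l, r j ≤ s) (d - 1)

lemma runLetter_eq {l : ℕ} (hl : l < d) (h1 : ∑ j ∈ Finset.range l, r j ≤ s)
    (h2 : s < ∑ j ∈ Finset.range (l + 1), r j) : runLetter d r s = l := by
  rw [runLetter, Nat.findGreatest_eq_iff]
  refine ⟨by omega, fun _ => h1, fun n hn _ h3 => ?_⟩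
  have : ∑ j ∈ Finset.range (l + 1), r j ≤ ∑ j ∈ Finset.range n, r j :=
    Finset.sum_le_sum_of_subset (Finset.range_subset_range.2 hn)
  omega

lemma runLetter_lt (hd : 0 < d) : runLetter d r s < d := by
  have : runLetter d r s ≤ d - 1 := Nat.findGreatest_le _
  omega

lemma sum_range_runLetter_le : ∑ j ∈ Finset.range (runLetter d r s), r j ≤ s :=
  Nat.findGreatest_spec (P := fun l => ∑ j ∈ Finset.range l, r j ≤ s) (m := 0)
    (Nat.zero_le _) (by simp)

lemma lt_sum_range_runLetter (hs : s < ∑ j ∈ Finset.range d, r j) :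
    s < ∑ j ∈ Finset.range (runLetter d r s + 1), r j := by
  have hd : 0 < d := Nat.pos_of_ne_zero (by rintro rfl; simp at hs)
  by_contra! hc
  rcases Nat.lt_or_ge (d - 1) (runLetter d r s + 1) with h | h
  · have := runLetter_lt (r := r) (s := s) hd
    rw [show runLetter d r s + 1 = d by omega] at hc
    omega
  · have : runLetter d r s + 1 ≤ runLetter d r s := Nat.le_findGreatest h hc
    omega

lemma runLetter_ne_zero (hs : s < ∑ l ∈ Finset.range d, r l) (h : r 0 ≤ s) :
    runLetter d r s ≠ 0 := fun h0 => by
  have := lt_sum_range_runLetter hs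
  rw [h0, zero_add, Finset.sum_range_one] at this
  omega

lemma sum_runLetter {M : Type*} [AddCommMonoid M] (v : ℕ → M) :
    ∑ s ∈ Finset.range (∑ l ∈ Finset.range d, r l), v (runLetter d r s) =
      ∑ l ∈ Finset.range d, r l • v l := by
  suffices ∀ L ≤ d, ∑ s ∈ Finset.range (∑ l ∈ Finset.range L, r l), v (runLetter d r s) =
      ∑ l ∈ Finset.range L, r l • v l from this d le_rfl
  intro L hL
  induction L with
  | zero => simp
  | succ L ih =>
    have hrun : ∀ s ∈ Finset.range (r L),
        runLetter d r (∑ l ∈ Finset.range L, r l + s) = L := fun s hs =>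
      runLetter_eq hL (Nat.le_add_right _ _) (by
        rw [Finset.sum_range_succ]
        exact Nat.add_lt_add_left (Finset.mem_range.1 hs) _)
    rw [Finset.sum_range_succ (fun l => r l • v l), Finset.sum_range_succ r,
      Finset.sum_range_add, ih (by omega),
      Finset.sum_congr (rfl : Finset.range (r L) = _) fun s hs => congrArg v (hrun s hs),
      Finset.sum_const, Finset.card_range]

lemma runLetter_window (hr : ∀ l < d, b ≤ r l) {n : ℕ} (hn0 : 0 < n) (hn : n ≤ b)
    (hsn : s + n ≤ ∑ l ∈ Finset.range d, r l) :
    ∃ j < d, ∃ a ≤ n, ∀ t < n, runLetter d r (s + t) = if t < a then j else j + 1 := by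
  have hd : 0 < d := Nat.pos_of_ne_zero (by rintro rfl; simp at hsn; omega)
  have hlt := lt_sum_range_runLetter (d := d) (r := r) (s := s) (by omega)
  have hle := sum_range_runLetter_le (d := d) (r := r) (s := s)
  have hjd := runLetter_lt (r := r) (s := s) hd
  set j := runLetter d r s
  refine ⟨j, hjd, min n (∑ l ∈ Finset.range (j + 1), r l - s), min_le_left _ _, fun t ht => ?_⟩
  split_ifs with hta
  · exact runLetter_eq hjd (by omega) (by omega)
  · have hj1 : j + 1 < d := by
      by_contra! hc
      rw [show j + 1 = d by omega] at hta
      omega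
    have := hr _ hj1
    refine runLetter_eq hj1 (by omega) ?_
    rw [Finset.sum_range_succ]
    omega

/-- The letters of the word `0^{k+1} 1 0^{r 0 - k - 1} 1^{r 1 - 1} 2^{r 2} ⋯ (d-1)^{r (d-1)}`: the
tag `1` at position `k + 1` distinguishes the words with different `k`. -/
def taggedLetter (d : ℕ) (r : ℕ → ℕ) (k s : ℕ) : ℕ :=
  if s = k + 1 then 1 else if s ≤ r 0 then 0 else runLetter d r s

lemma taggedLetter_tag : taggedLetter d r k (k + 1) = 1 := if_pos rfl

lemma taggedLetter_of_le (hs : s ≤ r 0) (hsk : s ≠ k + 1) : taggedLetter d r k s = 0 := by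
  rw [taggedLetter, if_neg hsk, if_pos hs]

lemma taggedLetter_of_lt (hk : k + 1 ≤ r 0) (hs : r 0 < s) :
    taggedLetter d r k s = runLetter d r s := by
  rw [taggedLetter, if_neg (by omega), if_neg (by omega)]

lemma taggedLetter_lt (hd : 2 ≤ d) (s : ℕ) : taggedLetter d r k s < d := by
  rw [taggedLetter]
  split_ifs
  · omega
  · omega
  · exact runLetter_lt (by omega)

lemma le_of_taggedLetter_eq_zero (hk : k + 1 ≤ r 0) (hs : s < ∑ l ∈ Finset.range d, r l)
    (h : taggedLetter d r k s = 0) : s ≤ r 0 ∧ s ≠ k + 1 := by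
  refine ⟨?_, fun hsk => one_ne_zero (taggedLetter_tag.symm.trans (hsk ▸ h))⟩
  by_contra! hr
  exact runLetter_ne_zero hs hr.le ((taggedLetter_of_lt hk hr).symm.trans h)

lemma add_le_sum_range (hd : 2 ≤ d) (r : ℕ → ℕ) : r 0 + r 1 ≤ ∑ l ∈ Finset.range d, r l := by
  calc r 0 + r 1 = ∑ l ∈ Finset.range 2, r l := (Finset.sum_range_succ r 1).symm ▸ by simp
    _ ≤ _ := Finset.sum_le_sum_of_subset (Finset.range_subset_range.2 hd)

lemma taggedLetter_eq_runLetter_swap (hd : 2 ≤ d) (hr : 1 ≤ r 1) (hk : k + 1 ≤ r 0) :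
    taggedLetter d r k s = runLetter d r (Equiv.swap (k + 1) (r 0) s) := by
  have h0 : ∀ s < r 0, runLetter d r s = 0 := fun s hs =>
    runLetter_eq (by omega) (by simp) (by simpa using hs)
  have h1 : runLetter d r (r 0) = 1 :=
    runLetter_eq (by omega) (by simp) (by simp [Finset.sum_range_succ]; omega)
  rcases eq_or_ne s (k + 1) with rfl | hsk
  · rw [taggedLetter_tag, Equiv.swap_apply_left, h1]
  rcases lt_trichotomy s (r 0) with hs | rfl | hs
  · rw [taggedLetter_of_le hs.le hsk, Equiv.swap_apply_of_ne_of_ne hsk hs.ne, h0 s hs]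
  · rw [taggedLetter_of_le le_rfl hsk, Equiv.swap_apply_right, h0 _ (by omega)]
  · rw [taggedLetter_of_lt hk hs, Equiv.swap_apply_of_ne_of_ne hsk hs.ne']

lemma sum_taggedLetter {M : Type*} [AddCommMonoid M] (hd : 2 ≤ d) (hr : 1 ≤ r 1)
    (hk : k + 1 ≤ r 0) (v : ℕ → M) :
    ∑ s ∈ Finset.range (∑ l ∈ Finset.range d, r l), v (taggedLetter d r k s) =
      ∑ l ∈ Finset.range d, r l • v l := by
  have hsum := add_le_sum_range hd r
  simp only [taggedLetter_eq_runLetter_swap hd hr hk]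
  rw [Equiv.Perm.sum_comp (Equiv.swap (k + 1) (r 0)) _ fun s => v (runLetter d r s),
    sum_runLetter]
  intro s hs
  rw [Finset.coe_range, Set.mem_Iio]
  rcases Equiv.swap_apply_ne_self_iff.1 hs with ⟨-, rfl | rfl⟩ <;> omega

lemma taggedLetter_of_sum_le_add (hd : 2 ≤ d) (hr : ∀ l < d, b ≤ r l) (hk : k + 1 ≤ r 0)
    (hs : s < ∑ l ∈ Finset.range d, r l) (hs' : ∑ l ∈ Finset.range d, r l < s + b) :
    taggedLetter d r k s = d - 1 := by
  obtain ⟨e, rfl⟩ := Nat.exists_eq_add_of_le' hd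
  have hlast := hr (e + 1) (by omega)
  have hsum : ∑ l ∈ Finset.range (e + 2), r l = ∑ l ∈ Finset.range (e + 1), r l + r (e + 1) :=
    Finset.sum_range_succ r (e + 1)
  have hfirst : r 0 ≤ ∑ l ∈ Finset.range (e + 1), r l :=
    Finset.single_le_sum (f := r) (fun _ _ => Nat.zero_le _) (by simp)
  rw [taggedLetter_of_lt hk (by omega)]
  exact runLetter_eq (by omega) (by simp only [Nat.add_one_sub_one]; omega) hs

lemma taggedLetter_window (hd : 2 ≤ d) (hr : ∀ l < d, b ≤ r l) (hk : k + 1 ≤ r 0) {n : ℕ}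
    (hn0 : 0 < n) (hn : n ≤ b) (hs : k + 1 < s) (hsn : s + n ≤ ∑ l ∈ Finset.range d, r l) :
    ∃ j < d, ∃ a ≤ n, ∀ t < n, taggedLetter d r k (s + t) = if t < a then j else j + 1 := by
  rcases Nat.lt_or_ge (r 0) s with h0 | h0
  · obtain ⟨j, hj, a, ha, hw⟩ := runLetter_window hr hn0 hn hsn
    exact ⟨j, hj, a, ha, fun t ht => (taggedLetter_of_lt hk (by omega)).trans (hw t ht)⟩
  · refine ⟨0, by omega, min n (r 0 + 1 - s), min_le_left _ _, fun t ht => ?_⟩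
    have := hr 1 (by omega)
    split_ifs with hta
    · exact taggedLetter_of_le (by omega) (by omega)
    · rw [taggedLetter_of_lt hk (by omega)]
      exact runLetter_eq (by omega) (by simp; omega) (by simp [Finset.sum_range_succ]; omega)

end Runs

/-! ### Substitutions with prescribed letter counts -/

/-- The set of words of length `n` occurring in a two-sided sequence. -/
def windows {α : Type*} (z : ℤ → α) (n : ℕ) : Set (Fin n → α) :=
  Set.range fun (c : ℤ) (j : Fin n) => z (c + (j : ℕ))

lemma ncard_windows_le_card {ι : Type*} [Fintype ι] {d n : ℕ} (z : ℤ → Fin d)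
    (f : ι → ℕ → ℕ) (h : ∀ c, ∃ p, ∀ t < n, (z (c + t) : ℕ) = f p t) :
    (windows z n).ncard ≤ Fintype.card ι := by
  have hsub : (Fin.val ∘ ·) '' windows z n ⊆ Set.range fun p (t : Fin n) => f p t := by
    rintro _ ⟨_, ⟨c, rfl⟩, rfl⟩
    obtain ⟨p, hp⟩ := h c
    exact ⟨p, funext fun t => (hp t t.2).symm⟩
  rw [← Set.ncard_image_of_injective _ Fin.val_injective.comp_left, ← Nat.card_eq_fintype_card,
    ← Set.ncard_univ]
  refine (Set.ncard_le_ncard hsub (Set.finite_range _)).trans ?_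
  rw [← Set.image_univ]
  exact Set.ncard_image_le Set.finite_univ

/-- `z` is the image of `y` under the substitution of constant length `m` given by `τ`. -/
def IsSubstituted {α β : Type*} (m : ℕ) (τ : β → ℕ → α) (z : ℤ → α) (y : ℤ → β) : Prop :=
  ∀ (q : ℤ) (s : ℕ), s < m → z (q * m + s) = τ (y q) s

/-- A substitution of constant length `m` with letter counts `B`, which is proper (all its words
begin with `first` and end with `last`), injective on letters, and recognizable: in a substituted
sequence, `last last.first` marks the seams between the words. -/
structure IsProperSubstitution {α β : Type*} [Fintype α] (m : ℕ) (B : Matrix β α ℤ)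
    (first last : α) (τ : β → ℕ → α) : Prop where
  sum_eq : ∀ k (v : α → ℤ), ∑ s ∈ Finset.range m, v (τ k s) = (B *ᵥ v) k
  first_eq : ∀ k, τ k 0 = first
  last_eq : ∀ k, τ k (m - 1) = last
  injective : ∀ k k', (∀ s < m, τ k s = τ k' s) → k = k'
  dvd_iff : ∀ z y, IsSubstituted m τ z y → ∀ n : ℤ,
    (m : ℤ) ∣ n ↔ z (n - 2) = last ∧ z (n - 1) = last ∧ z n = first

lemma exists_eq_mul_add {m : ℕ} (hm : 0 < m) (n : ℤ) :
    ∃ (q : ℤ) (s : ℕ), s < m ∧ n = q * m + s := by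
  have h0 : 0 ≤ n % (m : ℤ) := Int.emod_nonneg _ (by omega)
  have h1 : n % (m : ℤ) < m := Int.emod_lt_of_pos _ (by omega)
  refine ⟨n / m, (n % m).toNat, by omega, ?_⟩
  rw [Int.toNat_of_nonneg h0, Int.ediv_mul_add_emod]

section TaggedSubstitution

variable {d d' m b : ℕ} (hd : 2 ≤ d) {r : Fin d' → ℕ → ℕ}

/-- The substitution whose words are the tagged words with run lengths `r k`. -/
def taggedSubstitution (r : Fin d' → ℕ → ℕ) (k : Fin d') (s : ℕ) : Fin d :=
  ⟨taggedLetter d (r k) k s, taggedLetter_lt hd s⟩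

/-- The sequence `⋯ (d-1) (d-1) . 0^{k+1} 1 0 0 ⋯` seen around the seam before a tagged word. -/
def seamLetter (d k : ℕ) (i : ℤ) : ℕ :=
  if i < 0 then d - 1 else if i = k + 1 then 1 else 0

variable (hr : ∀ k, ∀ l < d, b ≤ r k l) (hm : ∀ k, ∑ l ∈ Finset.range d, r k l = m)

include hd hr hm

lemma two_mul_le_length (k : Fin d') : 2 * b ≤ m := by
  have := hr k 0 (by omega)
  have := hr k 1 (by omega)
  have := add_le_sum_range hd (r k)
  have := hm k
  omega

lemma sum_taggedSubstitution (hb : d' ≤ b) (k : Fin d') (v : Fin d → ℤ) :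
    ∑ s ∈ Finset.range m, v (taggedSubstitution hd r k s) = ∑ l : Fin d, r k l * v l := by
  have h0 := hr k 0 (by omega)
  have h1 := hr k 1 (by omega)
  have := k.isLt
  let v' : ℕ → ℤ := fun l => if h : l < d then v ⟨l, h⟩ else 0
  have hv' : ∀ s, v (taggedSubstitution hd r k s) = v' (taggedLetter d (r k) k s) := fun s => by
    simp only [v', taggedSubstitution, taggedLetter_lt hd s, dif_pos]
  simp only [hv']
  rw [← hm k, sum_taggedLetter hd (by omega) (by omega), Finset.sum_range]
  exact Finset.sum_congr rfl fun l _ => by simp [v']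

lemma taggedSubstitution_injective (hb : d' ≤ b) {k k' : Fin d'}
    (h : ∀ s < m, taggedSubstitution hd r k s = taggedSubstitution hd r k' s) : k = k' := by
  have hm2 := two_mul_le_length hd hr hm k
  by_contra hne
  have htag := Fin.ext_iff.1 (h (k + 1) (by omega))
  have hr0 := hr k' 0 (by omega)
  exact one_ne_zero (taggedLetter_tag.symm.trans
    (htag.trans (taggedLetter_of_le (by omega) (by omega))))

variable {z : ℤ → Fin d} {y : ℤ → Fin d'}

lemma IsSubstituted.eq_seamLetter (hz : IsSubstituted m (taggedSubstitution hd r) z y)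
    (hb : d' ≤ b) (q : ℤ) {i : ℤ} (hi : -b < i) (hi' : i ≤ b) (him : i < m) :
    (z (q * m + i) : ℕ) = seamLetter d (y q) i := by
  have hm2 := two_mul_le_length hd hr hm (y q)
  rw [seamLetter]
  split_ifs with hneg htag
  · obtain ⟨s, rfl⟩ : ∃ s : ℕ, i = s - m := ⟨(i + m).toNat, by omega⟩
    rw [show q * m + ((s : ℤ) - m) = (q - 1) * m + s by ring, hz _ _ (by omega)]
    have := hr (y (q - 1)) 0 (by omega)
    have := (y (q - 1)).isLt
    exact taggedLetter_of_sum_le_add hd (hr _) (by omega) (by rw [hm]; omega) (by rw [hm]; omega)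
  · lift i to ℕ using not_lt.1 hneg
    obtain rfl : i = y q + 1 := by exact_mod_cast htag
    rw [hz q _ (by omega)]
    exact taggedLetter_tag
  · lift i to ℕ using not_lt.1 hneg
    rw [hz q i (by omega)]
    exact taggedLetter_of_le ((Nat.cast_le.1 hi').trans (hr _ 0 (by omega))) (by omega)

lemma IsSubstituted.dvd_of_seam (hz : IsSubstituted m (taggedSubstitution hd r) z y)
    (hb : d' ≤ b) {n : ℤ} (h2 : (z (n - 2) : ℕ) = d - 1) (h1 : (z (n - 1) : ℕ) = d - 1)
    (h0 : (z n : ℕ) = 0) : (m : ℤ) ∣ n := by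
  have hm2 := two_mul_le_length hd hr hm (y 0)
  have := (y 0).isLt
  obtain ⟨q, s, hs, rfl⟩ := exists_eq_mul_add (m := m) (by omega) n
  have hr0 := hr (y q) 0 (by omega)
  obtain rfl | hs0 := eq_or_ne s 0
  · simp
  rw [hz q s hs] at h0
  obtain ⟨hsr, -⟩ := le_of_taggedLetter_eq_zero (by omega) (by rwa [hm]) h0
  rw [show q * m + (s : ℤ) - 1 = q * m + (s - 1 : ℕ) by omega, hz _ _ (by omega)] at h1
  have htag : s - 1 = y q + 1 := by
    by_contra hne
    have := h1.symm.trans (taggedLetter_of_le (r := r (y q)) (by omega) hne)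
    omega
  rw [show q * m + (s : ℤ) - 2 = q * m + (s - 2 : ℕ) by omega, hz _ _ (by omega)] at h2
  have := h2.symm.trans (taggedLetter_of_le (r := r (y q)) (by omega) (by omega))
  omega

lemma IsSubstituted.ncard_windows_le (hz : IsSubstituted m (taggedSubstitution hd r) z y)
    {n : ℕ} (hn : 0 < n) (hnb : n + d' ≤ b) :
    (windows z n).ncard ≤ (d + d') * (n + d' + 1) := by
  have hm2 := two_mul_le_length hd hr hm (y 0)
  let seam : Fin d' × Fin (n + d' + 1) → ℕ → ℕ := fun p t => seamLetter d p.1 (p.2 - n + t)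
  let step : Fin d × Fin (n + 1) → ℕ → ℕ := fun p t => if t < p.2 then p.1 else p.1 + 1
  have hcard := ncard_windows_le_card (n := n) z (Sum.elim seam step) fun c => by
    obtain ⟨q, s, hs, rfl⟩ := exists_eq_mul_add (m := m) (by omega) c
    rcases Nat.lt_or_ge m (s + n) with hseam | hin
    · refine ⟨Sum.inl (y (q + 1), ⟨n + s - m, by omega⟩), fun t ht => ?_⟩
      have := hz.eq_seamLetter hd hr hm (by omega) (q + 1) (i := s - m + t) (by omega) (by omega)
        (by omega)
      simp only [Sum.elim_inl, seam]
      convert this using 3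
      · ring
      · omega
    rcases Nat.lt_or_ge s (y q + 2) with htag | htag
    · refine ⟨Sum.inl (y q, ⟨n + s, by omega⟩), fun t ht => ?_⟩
      have := hz.eq_seamLetter hd hr hm (by omega) q (i := s + t) (by omega) (by omega) (by omega)
      simp only [Sum.elim_inl, seam]
      convert this using 3
      · ring
      · push_cast; ring
    · obtain ⟨j, hj, a, ha, hw⟩ := taggedLetter_window (k := y q) hd (hr (y q))
        (by have := hr (y q) 0 (by omega); omega) hn (by omega) htag (by rwa [hm])
      refine ⟨Sum.inr (⟨j, hj⟩, ⟨a, by omega⟩), fun t ht => ?_⟩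
      rw [add_assoc, ← Nat.cast_add, hz _ _ (by omega)]
      exact hw t ht
  simp only [Fintype.card_sum, Fintype.card_prod, Fintype.card_fin] at hcard
  nlinarith

end TaggedSubstitution

lemma exists_isProperSubstitution {d d' m b : ℕ} (hd : 2 ≤ d)
    {B : Matrix (Fin d') (Fin d) ℤ} (hb : d' + 3 ≤ b) (hB : ∀ k l, (b : ℤ) ≤ B k l)
    (hm : ∀ k, ∑ l, B k l = m) :
    ∃ (first last : Fin d) (τ : Fin d' → ℕ → Fin d), IsProperSubstitution m B first last τ ∧
      ∀ z y, IsSubstituted m τ z y → ∀ n, 0 < n → n + d' ≤ b →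
        (windows z n).ncard ≤ (d + d') * (n + d' + 1) := by
  let r : Fin d' → ℕ → ℕ := fun k l => if h : l < d then (B k ⟨l, h⟩).toNat else 0
  have hrB : ∀ k (l : Fin d), (r k l : ℤ) = B k l := fun k l => by
    have := hB k l
    simp only [r, l.isLt, dif_pos, Fin.eta]
    omega
  have hr : ∀ k, ∀ l < d, b ≤ r k l := fun k l hl => by
    exact_mod_cast (hB k ⟨l, hl⟩).trans (hrB k ⟨l, hl⟩).ge
  have hrm : ∀ k, ∑ l ∈ Finset.range d, r k l = m := fun k => by
    have : ((∑ l ∈ Finset.range d, r k l : ℕ) : ℤ) = m := by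
      rw [← hm k, Finset.sum_range, Nat.cast_sum]
      exact Finset.sum_congr rfl fun l _ => hrB k l
    exact_mod_cast this
  refine ⟨⟨0, by omega⟩, ⟨d - 1, by omega⟩, taggedSubstitution hd r,
    ⟨fun k v => ?_, fun k => ?_, fun k => ?_,
      fun k k' h => taggedSubstitution_injective hd hr hrm (by omega) h, fun z y hz n => ?_⟩,
    fun z y hz n hn hnb => hz.ncard_windows_le hd hr hrm hn hnb⟩
  · rw [sum_taggedSubstitution hd hr hrm (by omega)]
    exact Finset.sum_congr rfl fun l _ => by rw [hrB]
  · exact Fin.ext (taggedLetter_of_le (d := d) (r := r k) (k := k) (Nat.zero_le _) (by omega))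
  · have := two_mul_le_length hd hr hrm k
    have := hr k 0 (by omega)
    exact Fin.ext (taggedLetter_of_sum_le_add hd (hr k) (by omega) (by rw [hrm]; omega)
      (by rw [hrm]; omega))
  · refine ⟨?_, fun ⟨h2, h1, h0⟩ => hz.dvd_of_seam hd hr hrm (by omega)
      (Fin.ext_iff.1 h2) (Fin.ext_iff.1 h1) (Fin.ext_iff.1 h0)⟩
    rintro ⟨q, rfl⟩
    have hm2 := two_mul_le_length hd hr hrm (y q)
    have hseam : ∀ i : ℤ, -2 ≤ i → i ≤ 0 → (z (m * q + i) : ℕ) = if i < 0 then d - 1 else 0 := by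
      intro i hi hi0
      rw [mul_comm, hz.eq_seamLetter hd hr hrm (by omega) q (by omega) (by omega) (by omega),
        seamLetter, if_neg (by omega : i ≠ y q + 1)]
    exact ⟨Fin.ext (hseam (-2) (by omega) (by omega)), Fin.ext (hseam (-1) (by omega) (by omega)),
      Fin.ext (by simpa using hseam 0 (by omega) le_rfl)⟩

lemma mul_add_ediv {m s : ℕ} (hs : s < m) (q : ℤ) : (q * m + s) / (m : ℤ) = q := by
  rw [add_comm, Int.add_mul_ediv_right _ _ (by omega),
    Int.ediv_eq_zero_of_lt (by omega) (by omega), zero_add]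

lemma mul_add_emod {m s : ℕ} (hs : s < m) (q : ℤ) : (q * m + s) % (m : ℤ) = s := by
  rw [add_comm, Int.add_mul_emod_self_right, Int.emod_eq_of_lt (by omega) (by omega)]

section Recognizability

variable {α β : Type*} [Fintype α] {m : ℕ} {B : Matrix β α ℤ} {first last : α}
  {τ : β → ℕ → α} {z : ℤ → α} {y : ℤ → β}

lemma IsProperSubstitution.recognizable (hτ : IsProperSubstitution m B first last τ)
    (hm : 0 < m) (hz : IsSubstituted m τ z y) {R : ℕ} {n n' : ℤ}
    (hw : ∀ j : ℤ, |j| ≤ ((R + 2) * m : ℕ) → z (n + j) = z (n' + j)) :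
    ∃ (q q' : ℤ) (s : ℕ), s < m ∧ n = q * m + s ∧ n' = q' * m + s ∧
      ∀ j : ℤ, |j| ≤ R → y (q + j) = y (q' + j) := by
  obtain ⟨q, s, hs, rfl⟩ := exists_eq_mul_add hm n
  have hw' : ∀ j : ℤ, |j - s| ≤ ((R + 2) * m : ℕ) → z (q * m + j) = z (n' - s + j) :=
    fun j hj => by
      convert hw _ hj using 2 <;> ring
  have hseam : ∀ j : ℤ, -2 ≤ j → j ≤ 0 → z (q * m + j) = z (n' - s + j) := fun j hj hj0 =>
    hw' j (by rw [abs_le]; push_cast; constructor <;> nlinarith)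
  have hdvd : (m : ℤ) ∣ n' - s := by
    obtain ⟨h2, h1, h0⟩ := (hτ.dvd_iff z y hz (q * m)).1 (dvd_mul_left _ _)
    refine (hτ.dvd_iff z y hz _).2 ⟨?_, ?_, ?_⟩
    · exact (hseam (-2) le_rfl (by omega)).symm.trans h2
    · exact (hseam (-1) (by omega) (by omega)).symm.trans h1
    · simpa only [add_zero, h0] using (hseam 0 (by omega) le_rfl).symm
  obtain ⟨q', hq'⟩ := hdvd
  obtain rfl : n' = q' * m + s := by linear_combination hq'
  refine ⟨q, q', s, hs, rfl, rfl, fun j hj => hτ.injective _ _ fun r hr => ?_⟩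
  have h := hw' (j * m + r) (by
    rw [abs_le] at hj ⊢
    push_cast
    constructor <;> nlinarith)
  rw [← hz _ _ hr, ← hz _ _ hr]
  convert h using 2 <;> ring

lemma IsProperSubstitution.exists_letter_eq (hτ : IsProperSubstitution m B first last τ)
    (hB : ∀ k l, 0 < B k l) (k : β) (l : α) : ∃ s < m, τ k s = l := by
  classical
  have hsum := hτ.sum_eq k (Pi.single l 1)
  rw [Matrix.mulVec_single_one] at hsum
  obtain ⟨s, hs, hne⟩ := Finset.exists_ne_zero_of_sum_ne_zero (hsum.trans_ne (hB k l).ne')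
  exact ⟨s, Finset.mem_range.1 hs, by_contra fun hc => hne (Pi.single_eq_of_ne hc 1)⟩

end Recognizability

/-! ### Directive sequences -/

/-- A sequence of proper substitutions, from the alphabet of size `d (i + 1)` to the alphabet of
size `d i`, with the positive matrices `B i` as letter counts. -/
structure DirectiveSequence where
  d : ℕ → ℕ
  m : ℕ → ℕ
  B : ∀ i, Matrix (Fin (d (i + 1))) (Fin (d i)) ℤ
  first : ∀ i, Fin (d i)
  last : ∀ i, Fin (d i)
  τ : ∀ i, Fin (d (i + 1)) → ℕ → Fin (d i)
  two_le : ∀ i, 2 ≤ m i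
  B_pos : ∀ i k l, 0 < B i k l
  proper : ∀ i, IsProperSubstitution (m i) (B i) (first i) (last i) (τ i)

lemma natAbs_ediv_lt {m : ℕ} (hm : 2 ≤ m) {n : ℤ} (h0 : n ≠ 0) (h1 : n ≠ -1) :
    (n / m).natAbs < n.natAbs := by
  obtain ⟨q, s, hs, rfl⟩ := exists_eq_mul_add (m := m) (by omega) n
  rw [mul_add_ediv hs]
  rcases lt_trichotomy q (-1) with hq | rfl | hq
  · have : q * m + s < q := by nlinarith
    omega
  · omega
  · rcases Int.lt_or_le 0 q with hq' | hq'
    · have : q < q * m + s := by nlinarith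
      omega
    · obtain rfl : q = 0 := by omega
      simp at h0 ⊢
      omega

/-- A function of a window of bounded size of the sequence `x`. -/
def LocallyDetermined {α β : Type*} (x : ℤ → α) (F : ℤ → β) : Prop :=
  ∃ N : ℕ, ∀ n n' : ℤ, (∀ j : ℤ, |j| ≤ N → x (n + j) = x (n' + j)) → F n = F n'

lemma sum_range_mul {M : Type*} [AddCommMonoid M] (m h : ℕ) (f : ℕ → M) :
    ∑ r ∈ Finset.range (m * h), f r =
      ∑ s ∈ Finset.range m, ∑ r ∈ Finset.range h, f (s * h + r) := by
  induction m with
  | zero => simp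
  | succ m ih => rw [Nat.succ_mul, Finset.sum_range_add, ih, Finset.sum_range_succ]

namespace DirectiveSequence

variable (T : DirectiveSequence)

/-- The two-sided sequences with `seq i` the image of `seq (i + 1)` under `τ i`, which all of the
substitutions generate from the seed `last . first`. -/
def seq (i : ℕ) (n : ℤ) : Fin (T.d i) :=
  if n = 0 then T.first i else if n = -1 then T.last i else
    T.τ i (seq (i + 1) (n / T.m i)) (n % T.m i).toNat
termination_by n.natAbs
decreasing_by exact natAbs_ediv_lt (T.two_le i) ‹_› ‹_›

lemma isSubstituted_seq (i : ℕ) :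
    IsSubstituted (T.m i) (T.τ i) (T.seq i) (T.seq (i + 1)) := by
  intro q s hs
  have hm := T.two_le i
  have hs' := mul_add_emod hs q
  rw [seq]
  split_ifs with h0 h1
  · rw [h0, Int.zero_emod, eq_comm, Int.natCast_eq_zero] at hs'
    rw [hs', (T.proper i).first_eq]
  · rw [h1, ← Int.add_mul_emod_self_right (-1) 1, one_mul, Int.emod_eq_of_lt (by omega)
      (by omega)] at hs'
    rw [show s = T.m i - 1 by omega, (T.proper i).last_eq]
  · rw [hs', mul_add_ediv hs, Int.toNat_natCast]

/-- The common length `m 0 ⋯ m (i - 1)` of the words which `τ 0 ∘ ⋯ ∘ τ (i - 1)` substitutes for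
the letters of level `i`. -/
def height (i : ℕ) : ℕ := ∏ j ∈ Finset.range i, T.m j

lemma height_zero : T.height 0 = 1 := rfl

lemma height_succ (i : ℕ) : T.height (i + 1) = T.height i * T.m i := Finset.prod_range_succ _ _

lemma height_pos (i : ℕ) : 0 < T.height i :=
  Finset.prod_pos fun j _ => zero_lt_two.trans_le (T.two_le j)

lemma height_strictMono : StrictMono T.height := strictMono_nat_of_lt_succ fun i => by
  rw [height_succ]
  exact lt_mul_of_one_lt_right (T.height_pos i) (T.two_le i)

lemma lt_height (i : ℕ) : i < T.height i := by
  induction i with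
  | zero => exact T.height_pos 0
  | succ i ih => exact Nat.lt_of_le_of_lt ih (T.height_strictMono i.lt_succ_self)

lemma seq_mul (i : ℕ) (q : ℤ) : T.seq i (q * T.m i) = T.first i := by
  have := T.isSubstituted_seq i q 0 (zero_lt_two.trans_le (T.two_le i))
  rwa [Nat.cast_zero, add_zero, (T.proper i).first_eq] at this

lemma seq_mul_sub_one (i : ℕ) (q : ℤ) : T.seq i (q * T.m i - 1) = T.last i := by
  have hm := T.two_le i
  rw [← (T.proper i).last_eq, ← T.isSubstituted_seq i (q - 1) _ (by omega)]
  congr 1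
  rw [Nat.cast_sub (by omega)]
  ring

lemma exists_seq_eq (i : ℕ) (k : Fin (T.d i)) : ∃ n, T.seq i n = k := by
  obtain ⟨s, hs, hk⟩ := (T.proper i).exists_letter_eq (T.B_pos i) (T.seq (i + 1) 0) k
  exact ⟨_, (T.isSubstituted_seq i 0 s hs).trans hk⟩

/-- The values of `F` over a word of level `i` depend only on the letter of that word. -/
def LevelDetermined {β : Type*} (i : ℕ) (F : ℤ → β) : Prop :=
  ∀ (n n' : ℤ) (s : ℕ), s < T.height i → T.seq i n = T.seq i n' →
    F (n * T.height i + s) = F (n' * T.height i + s)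

variable {T}

lemma LevelDetermined.succ {β : Type*} {i : ℕ} {F : ℤ → β} (hF : T.LevelDetermined i F) :
    T.LevelDetermined (i + 1) F := by
  intro n n' s hs hn
  have hpos := T.height_pos i
  obtain ⟨a, b, hb, rfl⟩ : ∃ a b, b < T.height i ∧ s = a * T.height i + b :=
    ⟨_, _, Nat.mod_lt s hpos, (Nat.div_add_mod' s _).symm⟩
  have ha : a < T.m i := by
    rw [height_succ] at hs
    nlinarith
  have hsplit : ∀ n : ℤ, n * T.height (i + 1) + (a * T.height i + b : ℕ) =
      (n * T.m i + a) * T.height i + b := fun n => by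
    rw [height_succ]
    push_cast
    ring
  rw [hsplit, hsplit]
  exact hF _ _ _ hb (by rw [T.isSubstituted_seq i _ _ ha, T.isSubstituted_seq i _ _ ha, hn])

variable (T)

lemma levelDetermined_seq_zero (i : ℕ) : T.LevelDetermined i (T.seq 0) := by
  induction i with
  | zero =>
    intro n n' s hs hn
    obtain rfl : s = 0 := Nat.lt_one_iff.1 hs
    simpa [height_zero] using hn
  | succ i ih => exact ih.succ

lemma seq_zero_mul_height_add (i : ℕ) (n n' : ℤ) {j : ℤ} (hj : -(T.height i : ℤ) ≤ j)
    (hj' : j < T.height i) :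
    T.seq 0 (n * T.height (i + 1) + j) = T.seq 0 (n' * T.height (i + 1) + j) := by
  rcases Int.lt_or_le j 0 with h0 | h0
  · obtain ⟨s, rfl⟩ : ∃ s : ℕ, j = s - T.height i := ⟨(j + T.height i).toNat, by omega⟩
    have := T.levelDetermined_seq_zero i (n * T.m i - 1) (n' * T.m i - 1) s (by omega)
      (by rw [seq_mul_sub_one, seq_mul_sub_one])
    convert this using 2 <;> rw [height_succ] <;> push_cast <;> ring
  · lift j to ℕ using h0
    have := T.levelDetermined_seq_zero i (n * T.m i) (n' * T.m i) j (by omega)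
      (by rw [seq_mul, seq_mul])
    convert this using 2 <;> rw [height_succ] <;> push_cast <;> ring

lemma isToeplitzSeq : IsToeplitzSeq (T.seq 0) := by
  intro p
  refine ⟨T.height (p.natAbs + 1), T.height_pos _, fun k => ?_⟩
  have := T.lt_height p.natAbs
  have h := T.seq_zero_mul_height_add p.natAbs 0 k (j := p) (by omega) (by omega)
  rwa [zero_mul, zero_add, add_comm] at h

lemma exists_recognizable (i R : ℕ) :
    ∃ N : ℕ, ∀ n n' : ℤ, (∀ j : ℤ, |j| ≤ N → T.seq 0 (n + j) = T.seq 0 (n' + j)) →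
      ∃ (q q' : ℤ) (s : ℕ), s < T.height i ∧ n = q * T.height i + s ∧ n' = q' * T.height i + s ∧
        ∀ j : ℤ, |j| ≤ R → T.seq i (q + j) = T.seq i (q' + j) := by
  induction i generalizing R with
  | zero => exact ⟨R, fun n n' hw => ⟨n, n', 0, one_pos, by simp [height_zero],
      by simp [height_zero], hw⟩⟩
  | succ i ih =>
    obtain ⟨N, hN⟩ := ih ((R + 2) * T.m i)
    refine ⟨N, fun n n' hw => ?_⟩
    obtain ⟨p, p', t, ht, rfl, rfl, hp⟩ := hN n n' hw
    obtain ⟨q, q', s, hs, rfl, rfl, hq⟩ := (T.proper i).recognizable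
      (zero_lt_two.trans_le (T.two_le i)) (T.isSubstituted_seq i) hp
    have hlt : s * T.height i + t < T.height (i + 1) := by
      rw [height_succ]
      nlinarith
    refine ⟨q, q', _, hlt, ?_, ?_, hq⟩ <;> rw [height_succ] <;> push_cast <;> ring

variable {T}

lemma LevelDetermined.locallyDetermined {β : Type*} {i : ℕ} {F : ℤ → β}
    (hF : T.LevelDetermined i F) : LocallyDetermined (T.seq 0) F := by
  obtain ⟨N, hN⟩ := T.exists_recognizable i 0
  refine ⟨N, fun n n' hw => ?_⟩
  obtain ⟨q, q', s, hs, rfl, rfl, hq⟩ := hN n n' hw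
  exact hF q q' s hs (by simpa using hq 0 (by simp))

lemma exists_levelDetermined {β : Type*} {F : ℤ → β} (hF : LocallyDetermined (T.seq 0) F) :
    ∃ i, ∀ j ≥ i, T.LevelDetermined j F ∧
      ∀ n n' : ℤ, F (n * T.height j) = F (n' * T.height j) := by
  obtain ⟨N, hN⟩ := hF
  refine ⟨N + 1, fun j hj => ?_⟩
  obtain ⟨i, rfl⟩ : ∃ i, j = i + 1 := ⟨j - 1, by omega⟩
  have hNi : N < T.height i := (T.lt_height N).trans_le (T.height_strictMono.monotone (by omega))
  refine ⟨fun n n' s hs hn => hN _ _ fun t ht => ?_, fun n n' => hN _ _ fun t ht => ?_⟩ <;>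
    rw [abs_le] at ht
  · rcases Int.lt_or_le (s + t) 0 with hneg | hneg
    · rw [add_assoc, add_assoc]
      exact T.seq_zero_mul_height_add i n n' (by omega) (by omega)
    rcases Int.lt_or_le (s + t) (T.height (i + 1)) with hlt | hge
    · lift (s + t : ℤ) to ℕ using hneg with r hr
      rw [add_assoc, add_assoc, ← hr]
      exact T.levelDetermined_seq_zero (i + 1) n n' r (by omega) hn
    · have := T.seq_zero_mul_height_add i (n + 1) (n' + 1) (j := s + t - T.height (i + 1))
        (by omega) (by omega)
      convert this using 2 <;> ring
  · exact T.seq_zero_mul_height_add i n n' (by omega) (by omega)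

variable (T) in
/-- The sums of `F` over the words of level `i` are given by the vector `v`. -/
def HasSums (F : ℤ → ℤ) (i : ℕ) (v : Fin (T.d i) → ℤ) : Prop :=
  ∀ n : ℤ, ∑ r ∈ Finset.range (T.height i), F (n * T.height i + r) = v (T.seq i n)

section Sums

variable {F F' : ℤ → ℤ} {i j : ℕ} {v w : Fin (T.d i) → ℤ}

lemma HasSums.succ (hv : T.HasSums F i v) : T.HasSums F (i + 1) (T.B i *ᵥ v) := by
  intro n
  rw [← (T.proper i).sum_eq, height_succ, mul_comm, sum_range_mul]
  refine Finset.sum_congr rfl fun s hs => ?_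
  rw [← T.isSubstituted_seq i n s (Finset.mem_range.1 hs), ← hv]
  refine Finset.sum_congr rfl fun r _ => ?_
  push_cast
  ring_nf

lemma HasSums.transition (hv : T.HasSums F i v) (hij : i ≤ j) :
    T.HasSums F j (transition T.B i j hij v) := by
  induction j, hij using Nat.le_induction with
  | base => rwa [transition_self]
  | succ j hij ih => rw [transition_succ T.B hij]; exact ih.succ

lemma HasSums.unique (hv : T.HasSums F i v) (hw : T.HasSums F i w) : v = w := by
  ext k
  obtain ⟨n, rfl⟩ := T.exists_seq_eq i k
  rw [← hv, ← hw]

lemma HasSums.nonneg (hv : T.HasSums F i v) (hF : ∀ n, 0 ≤ F n) : 0 ≤ v := fun k => by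
  obtain ⟨n, rfl⟩ := T.exists_seq_eq i k
  rw [← hv]
  exact Finset.sum_nonneg fun r _ => hF _

lemma HasSums.add (hv : T.HasSums F i v) (hw : T.HasSums F' i w) :
    T.HasSums (F + F') i (v + w) := fun n => by
  simp only [Pi.add_apply, Finset.sum_add_distrib, hv n, hw n]

lemma LevelDetermined.exists_hasSums (hF : T.LevelDetermined i F) : ∃ v, T.HasSums F i v := by
  choose c hc using T.exists_seq_eq i
  exact ⟨fun k => ∑ r ∈ Finset.range (T.height i), F (c k * T.height i + r), fun n =>
    Finset.sum_congr rfl fun r hr => hF _ _ _ (Finset.mem_range.1 hr) (hc _).symm⟩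

lemma exists_hasSums (hF : LocallyDetermined (T.seq 0) F) : ∃ i v, T.HasSums F i v := by
  obtain ⟨i, hi⟩ := exists_levelDetermined hF
  exact ⟨i, (hi i le_rfl).1.exists_hasSums⟩

lemma exists_hasSums_sub_zero (hF : LocallyDetermined (T.seq 0) F) :
    ∃ i, T.HasSums (fun n => F (n + 1) - F n) i 0 := by
  obtain ⟨i, hi⟩ := exists_levelDetermined hF
  refine ⟨i, fun n => ?_⟩
  have htel := Finset.sum_range_sub (fun r : ℕ => F (n * T.height i + r)) (T.height i)
  have hper := (hi i le_rfl).2 (n + 1) n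
  simp only [Nat.cast_add, Nat.cast_one, ← add_assoc, Nat.cast_zero, add_zero] at htel
  rw [htel, Pi.zero_apply, sub_eq_zero, ← hper]
  congr 1
  ring

lemma LevelDetermined.exists_sub_eq (hF : T.LevelDetermined i F) (h0 : T.HasSums F i 0) :
    ∃ E : ℤ → ℤ, T.LevelDetermined i E ∧ ∀ n, E (n + 1) - E n = F n := by
  have hpos := T.height_pos i
  let E : ℤ → ℤ := fun n =>
    ∑ r ∈ Finset.range (n % T.height i).toNat, F (n / T.height i * T.height i + r)
  have hE : ∀ (q : ℤ) (s : ℕ), s < T.height i →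
      E (q * T.height i + s) = ∑ r ∈ Finset.range s, F (q * T.height i + r) := fun q s hs => by
    simp only [E, mul_add_ediv hs, mul_add_emod hs, Int.toNat_natCast]
  have hE' : ∀ (q : ℤ) (s : ℕ), s ≤ T.height i →
      E (q * T.height i + s) = ∑ r ∈ Finset.range s, F (q * T.height i + r) := fun q s hs => by
    rcases hs.lt_or_eq with hs | rfl
    · exact hE q s hs
    · rw [h0 q, ← add_one_mul, ← add_zero ((q + 1) * _), ← Nat.cast_zero, hE _ 0 hpos]
      rfl
  refine ⟨E, fun n n' s hs hn => ?_, fun n => ?_⟩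
  · rw [hE n s hs, hE n' s hs]
    exact Finset.sum_congr rfl fun r hr => hF _ _ _ ((Finset.mem_range.1 hr).trans hs) hn
  · obtain ⟨q, s, hs, rfl⟩ := exists_eq_mul_add hpos n
    rw [hE q s hs, add_assoc, ← Nat.cast_succ, hE' q (s + 1) hs, Finset.sum_range_succ,
      add_sub_cancel_left]

lemma exists_levelDetermined_hasSums (i : ℕ) (v : Fin (T.d i) → ℤ) :
    ∃ F : ℤ → ℤ, T.LevelDetermined i F ∧ T.HasSums F i v ∧ (0 ≤ v → ∀ n, 0 ≤ F n) := by
  have hpos := T.height_pos i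
  let F : ℤ → ℤ := fun n => if n % (T.height i : ℤ) = 0 then v (T.seq i (n / T.height i)) else 0
  have hF : ∀ (q : ℤ) (s : ℕ), s < T.height i →
      F (q * T.height i + s) = if s = 0 then v (T.seq i q) else 0 := fun q s hs => by
    simp only [F, mul_add_ediv hs, mul_add_emod hs, Int.natCast_eq_zero]
  refine ⟨F, fun n n' s hs hn => by rw [hF n s hs, hF n' s hs, hn], fun n => ?_, fun hv n => ?_⟩
  · rw [Finset.sum_congr rfl fun r hr => hF n r (Finset.mem_range.1 hr), Finset.sum_ite_eq',
      if_pos (Finset.mem_range.2 hpos)]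
  · simp only [F]
    split_ifs
    exacts [hv _, le_rfl]

lemma HasSums.map_eq {G : Type*} [AddCommGroup G] {P : Set G} {γ : ∀ i, (Fin (T.d i) → ℤ) →+ G}
    (hγ : IsPresentation P T.B γ) {w : Fin (T.d j) → ℤ} (hv : T.HasSums F i v)
    (hw : T.HasSums F j w) : γ i v = γ j w := by
  rw [← hγ.map_transition (le_max_left i j), ← hγ.map_transition (le_max_right i j),
    (hv.transition _).unique (hw.transition _)]

end Sums

end DirectiveSequence

/-! ### Orbit closures -/

section OrbitClosure

variable {α : Type*} [TopologicalSpace α]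

lemma exists_window_subset {Y : Set (ℤ → α)} {U : Set Y} (hU : IsOpen U) {y : Y} (hy : y ∈ U) :
    ∃ N : ℕ, ∀ y' : Y, (∀ j : ℤ, |j| ≤ N → y'.1 j = y.1 j) → y' ∈ U := by
  obtain ⟨V, hV, rfl⟩ := isOpen_induced_iff.1 hU
  obtain ⟨I, u, hu, hI⟩ := isOpen_pi_iff.1 hV y.1 hy
  refine ⟨I.sup Int.natAbs, fun y' h => hI fun j hj => ?_⟩
  rw [h j]
  · exact (hu j hj).2
  · rw [Int.abs_eq_natAbs]
    exact_mod_cast Finset.le_sup (f := Int.natAbs) hj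

/-- The subshift generated by the sequence `x`: the closure of its shift orbit. -/
def orbitClosure (x : ℤ → α) : Subshift α ℤ where
  carrier := closure (Set.range fun k : ℤ => shift k x)
  isClosed := isClosed_closure
  mapsTo g := by
    refine Set.MapsTo.closure ?_ (continuous_shift g)
    rintro _ ⟨k, rfl⟩
    exact ⟨k + g, shift_add k g x⟩

/-- The translate of `x` by `n`, as a point of the orbit closure of `x`. -/
def orbitPoint (x : ℤ → α) (n : ℤ) : (orbitClosure x).carrier :=
  ⟨shift n x, subset_closure ⟨n, rfl⟩⟩

variable {x : ℤ → α}

lemma orbitPoint_apply (n j : ℤ) : (orbitPoint x n).1 j = x (n + j) := rfl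

lemma shiftHomeo_orbitPoint (n : ℤ) :
    shiftHomeo (orbitClosure x) (orbitPoint x n) = orbitPoint x (n + 1) := by
  ext j
  exact congrArg x (add_assoc n 1 j).symm

lemma iterate_shiftHomeo_apply (Y : Subshift α ℤ) (y : Y.carrier) (j : ℕ) (t : ℤ) :
    ((shiftHomeo Y)^[j] y).1 t = y.1 (j + t) := by
  induction j generalizing t with
  | zero => simp
  | succ j ih =>
    rw [Function.iterate_succ_apply']
    refine (ih (1 + t)).trans (congrArg y.1 ?_)
    push_cast
    ring

variable [DiscreteTopology α]

lemma isOpen_window (y : ℤ → α) (N : ℕ) :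
    IsOpen {y' : ℤ → α | ∀ j : ℤ, |j| ≤ N → y' j = y j} := by
  convert isOpen_cylinder (Finset.Icc (-(N : ℤ)) N) y using 1
  ext y'
  simp [mem_cylinder, abs_le]

lemma exists_window_eq (y : (orbitClosure x).carrier) (N : ℕ) :
    ∃ n : ℤ, ∀ j : ℤ, |j| ≤ N → y.1 j = x (n + j) := by
  obtain ⟨_, h, n, rfl⟩ := mem_closure_iff.1 y.2 _ (isOpen_window y.1 N) fun _ _ => rfl
  exact ⟨n, fun j hj => (h j hj).symm⟩

lemma exists_orbitPoint_mem {U : Set (orbitClosure x).carrier} (hU : IsOpen U)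
    (hne : U.Nonempty) : ∃ n, orbitPoint x n ∈ U := by
  obtain ⟨y, hy⟩ := hne
  obtain ⟨N, hN⟩ := exists_window_subset hU hy
  obtain ⟨n, hn⟩ := exists_window_eq y N
  exact ⟨n, hN _ fun j hj => (hn j hj).symm⟩

lemma languageOfLength_orbitClosure (n : ℕ) :
    languageOfLength (orbitClosure x) n = windows x n := by
  ext w
  constructor
  · rintro ⟨y, hy, i, hw⟩
    obtain ⟨c, hc⟩ := exists_window_eq ⟨y, hy⟩ (i.natAbs + n)
    refine ⟨c + i, ?_⟩
    ext1 j
    rw [hw]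
    exact (congrArg x (add_assoc c i j)).trans (hc _ (by rw [abs_le]; omega)).symm
  · rintro ⟨c, rfl⟩
    exact ⟨_, (orbitPoint x c).2, 0, fun j => by rw [orbitPoint_apply, zero_add]⟩

section Continuous

variable {β : Type*} [TopologicalSpace β]

lemma eq_of_orbitPoint [T2Space β] {f g : C((orbitClosure x).carrier, β)}
    (h : ∀ n, f (orbitPoint x n) = g (orbitPoint x n)) : f = g := by
  by_contra hne
  obtain ⟨y, hy⟩ := DFunLike.ne_iff.1 hne
  obtain ⟨n, hn⟩ := exists_orbitPoint_mem (isOpen_ne_fun f.continuous g.continuous) ⟨y, hy⟩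
  exact hn (h n)

lemma exists_continuous_of_locallyDetermined {F : ℤ → β} (hF : LocallyDetermined x F) :
    ∃ f : C((orbitClosure x).carrier, β), ∀ n, f (orbitPoint x n) = F n := by
  obtain ⟨N, hN⟩ := hF
  choose c hc using fun y : (orbitClosure x).carrier => exists_window_eq y N
  have hlc : IsLocallyConstant fun y => F (c y) :=
    (IsLocallyConstant.iff_exists_open _).2 fun y =>
      ⟨_, (isOpen_window y.1 N).preimage continuous_subtype_val, fun _ _ => rfl, fun y' hy' =>
        hN _ _ fun j hj => by rw [← hc y' j hj, ← hc y j hj]; exact hy' j hj⟩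
  exact ⟨⟨_, hlc.continuous⟩, fun n => hN _ _ fun j hj => (hc (orbitPoint x n) j hj).symm⟩

variable [DiscreteTopology β]

lemma exists_orbitPoint_eq (f : C((orbitClosure x).carrier, β)) (y : (orbitClosure x).carrier) :
    ∃ n, f (orbitPoint x n) = f y :=
  exists_orbitPoint_mem ((isOpen_discrete {f y}).preimage f.continuous) ⟨y, rfl⟩

lemma locallyDetermined_of_continuous [Finite α] (f : C((orbitClosure x).carrier, β)) :
    LocallyDetermined x fun n => f (orbitPoint x n) := by
  let U : ℕ → Set (orbitClosure x).carrier := fun N =>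
    {y | ∀ y' : (orbitClosure x).carrier, (∀ j : ℤ, |j| ≤ N → y'.1 j = y.1 j) → f y' = f y}
  have isOpen_U : ∀ N, IsOpen (U N) := fun N => isOpen_iff_forall_mem_open.2 fun y hy => by
    refine ⟨_, fun z hz z' hz' => ?_, (isOpen_window y.1 N).preimage continuous_subtype_val,
      fun _ _ => rfl⟩
    rw [hy z hz, hy z' fun j hj => (hz' j hj).trans (hz j hj)]
  have cover : Set.univ ⊆ ⋃ N, U N := fun y _ => Set.mem_iUnion.2 <|
    exists_window_subset ((isOpen_discrete {f y}).preimage f.continuous) rfl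
  have monotone_U : Monotone U := fun N N' h y hy y' hy' =>
    hy y' fun j hj => hy' j (hj.trans (by exact_mod_cast h))
  have : CompactSpace (orbitClosure x).carrier :=
    isCompact_iff_compactSpace.1 (orbitClosure x).isClosed.isCompact
  obtain ⟨N, hN⟩ := isCompact_univ.elim_directed_cover U isOpen_U cover monotone_U.directed_le
  exact ⟨N, fun n n' h => hN (Set.mem_univ (orbitPoint x n')) (orbitPoint x n) h⟩

end Continuous

/-- Every central window of `x` recurs in `x` with bounded gaps. -/
def UniformlyRecurrent {β : Type*} (x : ℤ → β) : Prop :=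
  ∀ N : ℕ, ∃ R : ℕ, ∀ n : ℤ, ∃ j ≤ R, ∀ t : ℤ, |t| ≤ N → x (n + (j : ℕ) + t) = x t

lemma UniformlyRecurrent.exists_iterate_mem (hx : UniformlyRecurrent x)
    {U : Set (orbitClosure x).carrier} (hU : IsOpen U) (h0 : orbitPoint x 0 ∈ U)
    (y : (orbitClosure x).carrier) : ∃ j : ℕ, (shiftHomeo (orbitClosure x))^[j] y ∈ U := by
  obtain ⟨N, hN⟩ := exists_window_subset hU h0
  obtain ⟨R, hR⟩ := hx N
  obtain ⟨n, hn⟩ := exists_window_eq y (R + N)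
  obtain ⟨j, hj, hjt⟩ := hR n
  refine ⟨j, hN _ fun t ht => ?_⟩
  rw [iterate_shiftHomeo_apply, hn, ← add_assoc, hjt t ht, orbitPoint_apply, zero_add]
  rw [abs_le] at ht ⊢
  push_cast
  omega

lemma UniformlyRecurrent.isMinimalSystem (hx : UniformlyRecurrent x) :
    IsMinimalSystem (shiftHomeo (orbitClosure x)) := by
  refine ⟨⟨orbitPoint x 0⟩, fun C hC hinv => or_iff_not_imp_left.2 fun hne => ?_⟩
  obtain ⟨y, hy⟩ := Set.nonempty_iff_ne_empty.2 hne
  have mem_iff : ∀ z, shiftHomeo (orbitClosure x) z ∈ C ↔ z ∈ C := fun z => by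
    conv_lhs => rw [← hinv, (shiftHomeo (orbitClosure x)).injective.mem_set_image]
  have iterate_mem : ∀ j, (shiftHomeo (orbitClosure x))^[j] y ∈ C := fun j =>
    Set.MapsTo.iterate (fun z => (mem_iff z).2) j hy
  have orbitPoint_mem : ∀ n : ℤ, orbitPoint x n ∈ C := fun n => by
    induction n using Int.induction_on with
    | zero =>
      by_contra hc
      obtain ⟨j, hj⟩ := hx.exists_iterate_mem hC.isOpen_compl hc y
      exact hj (iterate_mem j)
    | succ i hi => rwa [← shiftHomeo_orbitPoint, mem_iff]
    | pred i hi => rwa [← mem_iff, shiftHomeo_orbitPoint, sub_add_cancel]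
  by_contra hc
  obtain ⟨n, hn⟩ := exists_orbitPoint_mem hC.isOpen_compl (Set.nonempty_compl.2 hc)
  exact hn (orbitPoint_mem n)

end OrbitClosure

/-! ### The dimension group of the subshift of a directive sequence -/

namespace DirectiveSequence

variable (T : DirectiveSequence)

/-- The subshift generated by the bottom sequence of a directive sequence. -/
abbrev subshift : Subshift (Fin (T.d 0)) ℤ := orbitClosure (T.seq 0)

lemma uniformlyRecurrent : UniformlyRecurrent (T.seq 0) := fun N => by
  refine ⟨T.height (N + 1), fun n => ?_⟩
  have hN := T.lt_height N
  have hpos := T.height_pos (N + 1)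
  obtain ⟨q, s, hs, hn⟩ := exists_eq_mul_add hpos (-n)
  refine ⟨s, hs.le, fun t ht => ?_⟩
  rw [abs_le] at ht
  have := T.seq_zero_mul_height_add N (-q) 0 (j := t) (by omega) (by omega)
  rwa [zero_mul, zero_add, show -q * T.height (N + 1) + t = n + s + t by linear_combination hn]
    at this

lemma isToeplitzSubshift : IsToeplitzSubshift T.subshift := ⟨T.seq 0, T.isToeplitzSeq, rfl⟩

variable {T}

/-- The sums of `f` along the words of level `i` in the orbit of the bottom sequence are given by
the vector `v`. -/
def HasOrbitSums (f : C(T.subshift.carrier, ℤ)) (i : ℕ) (v : Fin (T.d i) → ℤ) : Prop :=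
  T.HasSums (fun n => f (orbitPoint (T.seq 0) n)) i v

lemma exists_hasOrbitSums (f : C(T.subshift.carrier, ℤ)) : ∃ i v, HasOrbitSums f i v :=
  exists_hasSums (locallyDetermined_of_continuous f)

lemma coboundary_orbitPoint (f : C(T.subshift.carrier, ℤ)) (n : ℤ) :
    coboundary (shiftHomeo T.subshift) f (orbitPoint (T.seq 0) n) =
      f (orbitPoint (T.seq 0) (n + 1)) - f (orbitPoint (T.seq 0) n) := by
  rw [← shiftHomeo_orbitPoint]
  rfl

section SumHom

variable {G : Type*} [AddCommGroup G] {P : Set G} {γ : ∀ i, (Fin (T.d i) → ℤ) →+ G}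

/-- The homomorphism `C(Y, ℤ) → G` which sends a function with sums `v` over the words of level
`i` to `γ i v`. -/
noncomputable def sumHom (hγ : IsPresentation P T.B γ) : C(T.subshift.carrier, ℤ) →+ G :=
  AddMonoidHom.mk'
    (fun f => γ (exists_hasOrbitSums f).choose (exists_hasOrbitSums f).choose_spec.choose)
    fun f g => by
      have hf := (exists_hasOrbitSums f).choose_spec.choose_spec
      have hg := (exists_hasOrbitSums g).choose_spec.choose_spec
      have hfg := (exists_hasOrbitSums (f + g)).choose_spec.choose_spec
      have hsum := (hf.transition (le_max_left _ _)).add (hg.transition (le_max_right _ _))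
      refine (hfg.map_eq hγ hsum).trans ?_
      rw [map_add, hγ.map_transition, hγ.map_transition]

lemma sumHom_eq (hγ : IsPresentation P T.B γ) {f : C(T.subshift.carrier, ℤ)} {i : ℕ}
    {v : Fin (T.d i) → ℤ} (hv : HasOrbitSums f i v) : sumHom hγ f = γ i v :=
  (exists_hasOrbitSums f).choose_spec.choose_spec.map_eq hγ hv

lemma mem_range_coboundary_of_sumHom_eq_zero (hγ : IsPresentation P T.B γ)
    {f : C(T.subshift.carrier, ℤ)} (hf : sumHom hγ f = 0) :
    f ∈ (coboundary (shiftHomeo T.subshift)).range := by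
  obtain ⟨i₀, v, hv⟩ := exists_hasOrbitSums f
  obtain ⟨i₁, h₁, hzero⟩ := hγ.vanishes i₀ v ((sumHom_eq hγ hv).symm.trans hf)
  obtain ⟨i₂, hdet⟩ := exists_levelDetermined (locallyDetermined_of_continuous f)
  have hsums := (hv.transition h₁).transition (le_max_left i₁ i₂)
  rw [hzero, map_zero] at hsums
  obtain ⟨E, hE, hEf⟩ := (hdet _ (le_max_right i₁ i₂)).1.exists_sub_eq hsums
  obtain ⟨g, hg⟩ := exists_continuous_of_locallyDetermined hE.locallyDetermined
  exact ⟨g, eq_of_orbitPoint fun n => by rw [coboundary_orbitPoint, hg, hg, hEf]⟩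

lemma ker_sumHom (hγ : IsPresentation P T.B γ) :
    (sumHom hγ).ker = (coboundary (shiftHomeo T.subshift)).range := by
  refine le_antisymm (fun f hf => mem_range_coboundary_of_sumHom_eq_zero hγ hf) ?_
  rintro _ ⟨f, rfl⟩
  obtain ⟨i, hi⟩ := exists_hasSums_sub_zero (locallyDetermined_of_continuous f)
  refine (sumHom_eq hγ (i := i) (v := 0) ?_).trans (map_zero _)
  simpa only [HasOrbitSums, coboundary_orbitPoint] using hi

lemma exists_sumHom_eq (hγ : IsPresentation P T.B γ) (i : ℕ) (v : Fin (T.d i) → ℤ) :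
    ∃ f : C(T.subshift.carrier, ℤ), sumHom hγ f = γ i v ∧ (0 ≤ v → ∀ y, 0 ≤ f y) := by
  obtain ⟨F, hdet, hsums, hF⟩ := exists_levelDetermined_hasSums i v
  obtain ⟨f, hf⟩ := exists_continuous_of_locallyDetermined hdet.locallyDetermined
  refine ⟨f, sumHom_eq hγ ?_, fun hv y => ?_⟩
  · simpa only [HasOrbitSums, hf] using hsums
  · obtain ⟨n, hn⟩ := exists_orbitPoint_eq f y
    rw [← hn, hf]
    exact hF hv n

theorem orderedGroupIso (hγ : IsPresentation P T.B γ) :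
    OrderedGroupIso (dynHPos (shiftHomeo T.subshift)) (dynHUnit (shiftHomeo T.subshift)) P
      (γ 0 1) := by
  have surjective_sumHom : Function.Surjective (sumHom hγ) := fun g => by
    obtain ⟨i, v, rfl⟩ := hγ.surj g
    obtain ⟨f, hf, -⟩ := exists_sumHom_eq hγ i v
    exact ⟨f, hf⟩
  let φ : DynH (shiftHomeo T.subshift) ≃+ G :=
    (QuotientAddGroup.quotientAddEquivOfEq (ker_sumHom hγ).symm).trans
      (QuotientAddGroup.quotientKerEquivOfSurjective _ surjective_sumHom)
  have φ_mk : ∀ f, φ (QuotientAddGroup.mk f) = sumHom hγ f := fun f => rfl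
  refine ⟨φ, Set.Subset.antisymm ?_ fun g hg => ?_, ?_⟩
  · rintro _ ⟨_, ⟨f, hf, rfl⟩, rfl⟩
    obtain ⟨i, v, hv⟩ := exists_hasOrbitSums f
    exact (hγ.mem_iff _).2
      ⟨i, v, hv.nonneg fun n => hf _, ((φ_mk f).trans (sumHom_eq hγ hv)).symm⟩
  · obtain ⟨i, v, hv, rfl⟩ := (hγ.mem_iff g).1 hg
    obtain ⟨f, hf, hf0⟩ := exists_sumHom_eq hγ i v
    exact ⟨_, ⟨f, hf0 hv, rfl⟩, (φ_mk f).trans hf⟩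
  · refine (φ_mk _).trans (sumHom_eq hγ fun n => ?_)
    simp [height_zero]

end SumHom

end DirectiveSequence

/-! ### Complexity -/

namespace DirectiveSequence

variable {T : DirectiveSequence}

lemma LevelDetermined.ncard_windows_le_mul {α : Type*} {i : ℕ} {F : ℤ → α}
    (hF : T.LevelDetermined i F) {n l : ℕ} (hl : n + T.height i ≤ l * T.height i) :
    (windows F n).ncard ≤ T.height i * (windows (T.seq i) l).ncard := by
  have hpos := T.height_pos i
  choose c hc using T.exists_seq_eq i
  have hlt : ∀ (s : Fin (T.height i)) (t : Fin n), (s + t : ℕ) / T.height i < l := fun s t =>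
    Nat.div_lt_of_lt_mul (by rw [mul_comm]; omega)
  let f : Fin (T.height i) × (Fin l → Fin (T.d i)) → Fin n → α := fun p t =>
    F (c (p.2 ⟨(p.1 + t : ℕ) / T.height i, hlt p.1 t⟩) * T.height i +
      ((p.1 + t : ℕ) % T.height i : ℕ))
  have hsub : windows F n ⊆ f '' (Set.univ ×ˢ windows (T.seq i) l) := by
    rintro _ ⟨p, rfl⟩
    obtain ⟨q, s, hs, rfl⟩ := exists_eq_mul_add hpos p
    refine ⟨(⟨s, hs⟩, fun j : Fin l => T.seq i (q + (j : ℕ))), ⟨Set.mem_univ _, q, rfl⟩, ?_⟩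
    ext1 t
    have hdiv : ((s + t : ℕ) : ℤ) =
        T.height i * ((s + t) / T.height i : ℕ) + ((s + t) % T.height i : ℕ) := by
      exact_mod_cast (Nat.div_add_mod (s + t) (T.height i)).symm
    refine (hF _ _ _ (Nat.mod_lt _ hpos) (hc _)).trans (congrArg F ?_)
    push_cast at hdiv ⊢
    linear_combination -hdiv
  calc (windows F n).ncard ≤ (f '' (Set.univ ×ˢ windows (T.seq i) l)).ncard :=
        Set.ncard_le_ncard hsub (Set.toFinite _)
    _ ≤ (Set.univ ×ˢ windows (T.seq i) l : Set (Fin (T.height i) × _)).ncard :=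
        Set.ncard_image_le (Set.toFinite _)
    _ = _ := by rw [Set.ncard_prod, Set.ncard_univ, Nat.card_fin]

/-- Short words are compared with level `i`, whose words have few seams; once `n` exceeds a
fixed fraction of `T.height (i + 1)`, pairs of letters of level `i + 1` suffice. -/
lemma ncard_windows_le {i K b n : ℕ} (hm : T.m i = K * b) (hb : 2 * (T.d (i + 1) + 2) ≤ b)
    (hw : ∀ l, 0 < l → l + T.d (i + 1) ≤ b →
      (windows (T.seq i) l).ncard ≤ (T.d i + T.d (i + 1)) * (l + T.d (i + 1) + 1))
    (hn : T.height i ≤ n) (hn' : n ≤ T.height (i + 1)) :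
    (windows (T.seq 0) n).ncard ≤
      ((T.d i + T.d (i + 1)) * (T.d (i + 1) + 4) + 2 * K * T.d (i + 1) ^ 2) * n := by
  set e := T.d (i + 1)
  obtain ⟨q, hqn, hnq⟩ : ∃ q, T.height i * q ≤ n ∧ n < T.height i * (q + 1) :=
    ⟨n / T.height i, Nat.mul_div_le n _, Nat.lt_mul_div_succ n (T.height_pos i)⟩
  rcases Nat.lt_or_ge b (q + 2 + e) with hbq | hbq
  · have hle := (T.levelDetermined_seq_zero (i + 1)).ncard_windows_le_mul (n := n) (l := 2)
      (by omega)
    have hpairs : (windows (T.seq (i + 1)) 2).ncard ≤ e ^ 2 := by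
      simpa [Set.ncard_univ] using Set.ncard_le_ncard (Set.subset_univ (windows (T.seq (i + 1)) 2))
    have hheight : T.height (i + 1) ≤ 2 * K * n := by
      have : b ≤ 2 * q := by omega
      calc T.height (i + 1) = T.height i * (K * b) := by rw [height_succ, hm]
        _ ≤ T.height i * (K * (2 * q)) := by gcongr
        _ = 2 * K * (T.height i * q) := by ring
        _ ≤ 2 * K * n := by gcongr
    calc (windows (T.seq 0) n).ncard ≤ (2 * K * n) * e ^ 2 :=
          hle.trans (Nat.mul_le_mul hheight hpairs)
      _ = 2 * K * e ^ 2 * n := by ring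
      _ ≤ _ := Nat.mul_le_mul_right _ (Nat.le_add_left _ _)
  · have hle := (T.levelDetermined_seq_zero i).ncard_windows_le_mul (n := n) (l := q + 2)
      (by nlinarith)
    calc (windows (T.seq 0) n).ncard
        ≤ T.height i * ((T.d i + e) * (q + 2 + e + 1)) :=
          hle.trans (Nat.mul_le_mul_left _ (hw _ (by omega) hbq))
      _ = (T.d i + e) * (T.height i * q + T.height i * (e + 3)) := by ring
      _ ≤ (T.d i + e) * (n + n * (e + 3)) := by gcongr
      _ = (T.d i + e) * (e + 4) * n := by ring
      _ ≤ _ := Nat.mul_le_mul_right _ (Nat.le_add_right _ _)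

end DirectiveSequence

theorem exists_directiveSequence {G : Type*} [AddCommGroup G] {P : Set G} {u : G}
    (hG : IsSimpleDimensionGroupWithUnit G P u)
    (hdiv : ∀ (g : G) (k : ℕ), 1 ≤ k → ∃ h : G, k • h = g) :
    ∃ C : ℕ → ℕ, ∀ N : ℕ → ℕ, ∃ (T : DirectiveSequence) (γ : ∀ i, (Fin (T.d i) → ℤ) →+ G),
      IsPresentation P T.B γ ∧ γ 0 1 = u ∧ (∀ i, N (i + 1) ≤ T.height (i + 1)) ∧
      ∀ i n, T.height i ≤ n → n ≤ T.height (i + 1) → (windows (T.seq 0) n).ncard ≤ C i * n := by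
  obtain ⟨d, K, hd, hK, hpres⟩ := exists_balanced_presentation hG hdiv
  refine ⟨fun i => (d i + d (i + 1)) * (d (i + 1) + 4) + 2 * K i * d (i + 1) ^ 2, fun N => ?_⟩
  let b : ℕ → ℕ := fun i => max (2 * (d (i + 1) + 2)) (N (i + 1))
  have hdb : ∀ i, 2 * (d (i + 1) + 2) ≤ b i := fun i => le_max_left _ _
  have hbm : ∀ i, b i ≤ K i * b i := fun i => Nat.le_mul_of_pos_left _ (hK i)
  obtain ⟨B, γ, hB, hsum, hγ, hu⟩ := hpres b fun i => by have := hdb i; omega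
  choose first last τ hτ hw using fun i =>
    exists_isProperSubstitution (hd i) (by have := hd (i + 1); have := hdb i; omega) (hB i) (hsum i)
  let T : DirectiveSequence :=
    { d, B, first, last, τ
      m := fun i => K i * b i
      two_le := fun i => by have := hdb i; have := hbm i; omega
      B_pos := fun i k l => by have := hB i k l; have := hdb i; omega
      proper := hτ }
  refine ⟨T, γ, hγ, hu, fun i => ?_, fun i n => DirectiveSequence.ncard_windows_le rfl (hdb i)
    (hw i (T.seq i) (T.seq (i + 1)) (T.isSubstituted_seq i))⟩
  calc N (i + 1) ≤ T.m i := (le_max_right _ _).trans (hbm i)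
    _ ≤ T.height i * T.m i := Nat.le_mul_of_pos_left _ (T.height_pos i)
    _ = T.height (i + 1) := (T.height_succ i).symm

lemma exists_le_and_lt_succ_of_strictMono {h : ℕ → ℕ} (hh : StrictMono h) {j n : ℕ}
    (hj : h j ≤ n) : ∃ i ≥ j, h i ≤ n ∧ n < h (i + 1) := by
  induction n, hj using Nat.le_induction with
  | base => exact ⟨j, le_rfl, le_rfl, hh j.lt_succ_self⟩
  | succ n _ ih =>
    obtain ⟨i, hji, hin, hni⟩ := ih
    rcases Nat.lt_or_ge (n + 1) (h (i + 1)) with hlt | hge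
    · exact ⟨i, hji, hin.trans n.le_succ, hlt⟩
    · have := hh (i + 1).lt_add_one
      exact ⟨i + 1, by omega, hge, by omega⟩

open Filter Topology in
lemma exists_forall_tendsto_div {p : ℕ → ℝ} (hpos : ∀ n, 0 ≤ p n)
    (hp : Tendsto (fun n : ℕ => (n : ℝ) / p n) atTop (𝓝 0)) (C : ℕ → ℕ) :
    ∃ N : ℕ → ℕ, ∀ h c : ℕ → ℕ, StrictMono h → (∀ i, N (i + 1) ≤ h (i + 1)) →
      (∀ i n, h i ≤ n → n ≤ h (i + 1) → c n ≤ C i * n) →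
      Tendsto (fun n => (c n : ℝ) / p n) atTop (𝓝 0) := by
  have threshold : ∀ i, ∃ N, ∀ n ≥ N, (C i : ℝ) * (n / p n) < 1 / (i + 1) := fun i =>
    eventually_atTop.1 <| (hp.const_mul (C i : ℝ)).eventually_lt_const <| by
      rw [mul_zero]; positivity
  choose N hN using threshold
  refine ⟨N, fun h c hh hNh hc => tendsto_order.2 ⟨fun ε hε => .of_forall fun n =>
    hε.trans_le (div_nonneg (Nat.cast_nonneg _) (hpos n)), fun ε hε => ?_⟩⟩
  obtain ⟨j, hj⟩ := exists_nat_one_div_lt hε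
  filter_upwards [eventually_ge_atTop (h (j + 1))] with n hn
  obtain ⟨i, hji, hin, hni⟩ := exists_le_and_lt_succ_of_strictMono hh hn
  obtain ⟨i, rfl⟩ : ∃ i', i = i' + 1 := ⟨i - 1, by omega⟩
  calc (c n : ℝ) / p n ≤ (C (i + 1) * n : ℕ) / p n :=
        div_le_div_of_nonneg_right (Nat.cast_le.2 (hc _ n hin hni.le)) (hpos n)
    _ = C (i + 1) * (n / p n) := by rw [Nat.cast_mul, mul_div_assoc]
    _ < 1 / ((i + 1 : ℕ) + 1) := hN _ n ((hNh i).trans hin)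
    _ ≤ 1 / (j + 1) := by gcongr; omega
    _ < ε := hj

end DimToeplitz

theorem theorem3 {G : Type*} [AddCommGroup G] (P : Set G) (u : G)
    (hG : DimToeplitz.IsSimpleDimensionGroupWithUnit G P u)
    (hdiv : ∀ (g : G) (k : ℕ), 1 ≤ k → ∃ h : G, k • h = g)
    (p : ℕ → ℝ) (hpos : ∀ n, 0 < p n)
    (hp : Filter.Tendsto (fun n : ℕ => (n : ℝ) / p n) Filter.atTop (nhds 0)) :
    ∃ (a : ℕ) (Y : SymbolicDynamics.FullShift.Subshift (Fin a) ℤ),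
      DimToeplitz.IsMinimalSystem (DimToeplitz.shiftHomeo Y) ∧
      DimToeplitz.IsToeplitzSubshift Y ∧
      DimToeplitz.OrderedGroupIso
        (DimToeplitz.dynHPos (DimToeplitz.shiftHomeo Y))
        (DimToeplitz.dynHUnit (DimToeplitz.shiftHomeo Y)) P u ∧
      Filter.Tendsto (fun n : ℕ => (DimToeplitz.complexity Y n : ℝ) / p n)
        Filter.atTop (nhds 0) := by
  obtain ⟨C, hC⟩ := DimToeplitz.exists_directiveSequence hG hdiv
  obtain ⟨N, hN⟩ := DimToeplitz.exists_forall_tendsto_div (fun n => (hpos n).le) hp C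
  obtain ⟨T, γ, hγ, rfl, hNT, hwindows⟩ := hC N
  refine ⟨T.d 0, T.subshift, T.uniformlyRecurrent.isMinimalSystem, T.isToeplitzSubshift,
    DimToeplitz.DirectiveSequence.orderedGroupIso hγ, ?_⟩
  simp only [DimToeplitz.complexity, DimToeplitz.languageOfLength_orbitClosure]
  exact hN T.height _ T.height_strictMono hNT hwindows
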